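/- Let $s<t^*<t$, put $q=t^*-s$, $r=t-t^*$, $l=t-s$, and let $X=(X_u)_{u\in[s,t]}$ be a Brownian bridge from $X_s=x$ to $X_t=y$ with minimum $m=\inf_{u\in[s,t]}X_u$ and maximum $M=\sup_{u\in[s,t]}X_u$. Let $L^\downarrow,L^\uparrow,U^\downarrow,U^\uparrow$ be real numbers such that the event $A=\{m\in[L^\downarrow,L^\uparrow],\ M\in[U^\downarrow,U^\uparrow]\}$ has positive probability. For $k>0$ let $\gamma(L,U;k,a,b)=1-\zeta(L,U;k,a,b)$, where $\zeta(L,U;k,a,b)$ is the probability that a Brownian bridge on $[0,k]$ from $a$ to $b$ has minimum $<L$ or maximum $>U$. Define $$\rho(w)=\gamma(L^\downarrow,U^\uparrow;q,x,w)\,\gamma(L^\downarrow,U^\uparrow;r,w,y)-\gamma(L^\uparrow,U^\uparrow;q,x,w)\,\gamma(L^\uparrow,U^\uparrow;r,w,y)$$ $$\qquad-\gamma(L^\downarrow,U^\downarrow;q,x,w)\,\gamma(L^\downarrow,U^\downarrow;r,w,y)+\gamma(L^\uparrow,U^\downarrow;q,x,w)\,\gamma(L^\uparrow,U^\downarrow;r,w,y),$$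 $$\pi(w)=\exp\Bigl\{-\tfrac12\Bigl(w-\bigl(\tfrac rl x+\tfrac ql y\bigr)\Bigr)^2\Big/\Bigl(\tfrac{qr}{l}\Bigr)\Bigr\}.$$ Then $\rho(X_{t^*})$ is a version of the conditional probability $\mathbb P[L^\downarrow<m<L^\uparrow,\ U^\downarrow<M<U^\uparrow\mid X_{t^*}]$. The function $\rho\pi$ is nonnegative and integrable on $\mathbb R$ with $\int_{\mathbb R}\rho(v)\pi(v)\,dv>0$, and the distribution of $X_{t^*}$ conditional on $A$ has the probability density $$f(w)=\frac{\rho(w)\,\pi(w)}{\int_{\mathbb R}\rho(v)\,\pi(v)\,dv},\qquad w\in\mathbb R,$$ with respect to Lebesgue measure. -/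

import Mathlib

open MeasureTheory ProbabilityTheory

noncomputable section

namespace BrownianLayer

/-- `X = (X_u)_{u ∈ [s,t]}` is a Brownian bridge on `[s,t]` from `x` to `y` under `P`: a process
with almost surely continuous paths which is Gaussian, with the mean and the covariance of a
Brownian motion conditioned to be at `x` at time `s` and at `y` at time `t`. -/
structure IsBrownianBridge {Ω : Type*} [MeasurableSpace Ω] (s t x y : ℝ)
    (X : Set.Icc s t → Ω → ℝ) (P : Measure Ω) : Prop where
  measurable : ∀ u, Measurable (X u)
  gaussian : IsGaussianProcess X P
  mean : ∀ u, ∫ ω, X u ω ∂P = x + ((u : ℝ) - s) / (t - s) * (y - x)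
  covariance : ∀ u v, cov[X u, X v; P] = (min (u : ℝ) v - s) * (t - max (u : ℝ) v) / (t - s)
  continuous : ∀ᵐ ω ∂P, Continuous fun u ↦ X u ω

/-- Continuous paths on `[0,l]`, with the σ-algebra generated by the evaluations. -/
abbrev Path (l : ℝ) : Type := {f : Set.Icc (0 : ℝ) l → ℝ // Continuous f}

/-- A measure on paths under which the coordinate process is a Brownian bridge from `x` to `y`. -/
def IsBridgeLaw (l x y : ℝ) (W : Measure (Path l)) : Prop :=
  IsBrownianBridge 0 l x y (fun u (f : Path l) ↦ f.1 u) W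

open Classical in
/-- The law `𝕎^{(l,x,y)}` of the Brownian bridge on `[0,l]` from `x` to `y`. It is the unique
measure with `IsBridgeLaw`; `IsBrownianBridge.map_eq_bridgeLaw` shows that it is the law of every
Brownian bridge on `[0,l]` from `x` to `y` with continuous paths, on whatever probability space. -/
def bridgeLaw (l x y : ℝ) : Measure (Path l) :=
  if h : ∃ W, IsBridgeLaw l x y W then h.choose else 0

/-- The minimum of a path. -/
def pathInf {T : Type*} (f : T → ℝ) : ℝ := ⨅ u, f u

/-- The maximum of a path. -/
def pathSup {T : Type*} (f : T → ℝ) : ℝ := ⨆ u, f u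

/-- The probability that the Brownian bridge on `[0,l]` from `x` to `y` escapes `[L,U]`. -/
def zeta (L U l x y : ℝ) : ℝ :=
  (bridgeLaw l x y).real {f | pathInf f.1 < L ∨ U < pathSup f.1}

/-- The probability that the Brownian bridge on `[0,l]` from `x` to `y` stays in `[L,U]`. -/
def gamma (L U l x y : ℝ) : ℝ := 1 - zeta L U l x y

/-- The product form of the probability that a Brownian bridge on `[0,q+r]` from `x` to `y` which
is at `w` at time `q` has its minimum in the layer `(Ld,Lu)` and its maximum in the layer
`(Ud,Uu)`. -/
def rho (Ld Lu Ud Uu q r x w y : ℝ) : ℝ :=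
  gamma Ld Uu q x w * gamma Ld Uu r w y - gamma Lu Uu q x w * gamma Lu Uu r w y
    - gamma Ld Ud q x w * gamma Ld Ud r w y + gamma Lu Ud q x w * gamma Lu Ud r w y

/-- The unnormalised density at time `q` of a Brownian bridge on `[0,q+r]` from `x` to `y`. -/
def bridgeMarginal (q r x y w : ℝ) : ℝ :=
  Real.exp (-(1 / 2) * (w - (r / (q + r) * x + q / (q + r) * y)) ^ 2 / (q * r / (q + r)))

/-- The event that the minimum of the path lies in the layer `[Ld,Lu]` and its maximum in the layer
`[Ud,Uu]`. -/
def layerEvent {Ω T : Type*} (X : T → Ω → ℝ) (Ld Lu Ud Uu : ℝ) : Set Ω :=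
  {ω | pathInf (fun u ↦ X u ω) ∈ Set.Icc Ld Lu ∧ pathSup (fun u ↦ X u ω) ∈ Set.Icc Ud Uu}

/-- The finite-dimensional distributions of a Brownian bridge are determined by the end points. -/
theorem IsBrownianBridge.fdd_unique {Ω Ω' : Type*} [MeasurableSpace Ω] [MeasurableSpace Ω']
    {s t x y : ℝ} {X : Set.Icc s t → Ω → ℝ} {Y : Set.Icc s t → Ω' → ℝ} {P : Measure Ω}
    {Q : Measure Ω'} (hX : IsBrownianBridge s t x y X P) (hY : IsBrownianBridge s t x y Y Q)
    (I : Finset (Set.Icc s t)) :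
    P.map (fun ω ↦ I.restrict (X · ω)) = Q.map (fun ω ↦ I.restrict (Y · ω)) := by
  have mX : Measurable (fun ω ↦ I.restrict (X · ω)) :=
    measurable_pi_lambda _ fun i ↦ hX.measurable i
  have mY : Measurable (fun ω ↦ I.restrict (Y · ω)) :=
    measurable_pi_lambda _ fun i ↦ hY.measurable i
  have gX := (hX.gaussian.hasGaussianLaw I).isGaussian_map
  have gY := (hY.gaussian.hasGaussianLaw I).isGaussian_map
  have hmean : ∀ i : I, ∫ f, f i ∂(P.map (fun ω ↦ I.restrict (X · ω))) =
      ∫ f, f i ∂(Q.map (fun ω ↦ I.restrict (Y · ω))) := fun i ↦ by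
    rw [integral_map mX.aemeasurable (measurable_pi_apply i).aestronglyMeasurable,
      integral_map mY.aemeasurable (measurable_pi_apply i).aestronglyMeasurable]
    exact (hX.mean i).trans (hY.mean i).symm
  have hcov : ∀ i j : I, cov[fun f ↦ f i, fun f ↦ f j; P.map (fun ω ↦ I.restrict (X · ω))] =
      cov[fun f ↦ f i, fun f ↦ f j; Q.map (fun ω ↦ I.restrict (Y · ω))] := fun i j ↦ by
    rw [covariance_map (measurable_pi_apply i).aestronglyMeasurable
        (measurable_pi_apply j).aestronglyMeasurable mX.aemeasurable,
      covariance_map (measurable_pi_apply i).aestronglyMeasurable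
        (measurable_pi_apply j).aestronglyMeasurable mY.aemeasurable]
    exact (hX.covariance i j).trans (hY.covariance i j).symm
  generalize P.map (fun ω ↦ I.restrict (X · ω)) = μ at *
  generalize Q.map (fun ω ↦ I.restrict (Y · ω)) = ν at *
  apply (MeasurableEquiv.toLp 2 (_ → ℝ)).map_measurableEquiv_injective
  rw [MeasurableEquiv.coe_toLp, ← PiLp.coe_symm_continuousLinearEquiv 2 ℝ]
  apply IsGaussian.ext
  · rw [integral_map (by fun_prop) (by fun_prop), integral_map (by fun_prop) (by fun_prop)]
    simp only [id_eq]
    rw [ContinuousLinearEquiv.integral_comp_comm _ (fun f : I → ℝ ↦ f),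
      ContinuousLinearEquiv.integral_comp_comm _ (fun f : I → ℝ ↦ f)]
    congr 1
    ext i
    rw [eval_integral, eval_integral]
    · exact hmean i
    · exact fun j ↦ (gY.hasGaussianLaw_id.eval j).integrable
    · exact fun j ↦ (gX.hasGaussianLaw_id.eval j).integrable
  · rw [← ContinuousLinearMap.toBilinForm_inj]
    refine LinearMap.BilinForm.ext_of_isSymm isPosSemidef_covarianceBilin.isSymm
      isPosSemidef_covarianceBilin.isSymm fun v ↦ ?_
    simp only [ContinuousLinearMap.toBilinForm_apply]
    rw [PiLp.coe_symm_continuousLinearEquiv, covarianceBilin_apply_pi, covarianceBilin_apply_pi]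
    · congrm ∑ i, ∑ j, _ * ?_
      exact hcov i j
    · exact fun i ↦ (gY.hasGaussianLaw_id.eval i).memLp_two
    · exact fun i ↦ (gX.hasGaussianLaw_id.eval i).memLp_two

theorem measurable_path {Ω : Type*} [MeasurableSpace Ω] {l : ℝ}
    {X : Set.Icc (0 : ℝ) l → Ω → ℝ} (hm : ∀ u, Measurable (X u))
    (hc : ∀ ω, Continuous fun u ↦ X u ω) :
    Measurable (fun ω ↦ (⟨fun u ↦ X u ω, hc ω⟩ : Path l)) :=
  Measurable.subtype_mk (measurable_pi_lambda _ hm)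

theorem isBridgeLaw_map {Ω : Type*} [MeasurableSpace Ω] {l x y : ℝ}
    {X : Set.Icc (0 : ℝ) l → Ω → ℝ} {P : Measure Ω} (hX : IsBrownianBridge 0 l x y X P)
    (hc : ∀ ω, Continuous fun u ↦ X u ω) :
    IsBridgeLaw l x y (P.map fun ω ↦ (⟨fun u ↦ X u ω, hc ω⟩ : Path l)) := by
  have hm := measurable_path hX.measurable hc
  have he : ∀ u, Measurable (fun f : Path l ↦ f.1 u) := fun u ↦
    (measurable_pi_apply u).comp measurable_subtype_coe
  refine ⟨he, ⟨fun I ↦ ⟨?_⟩⟩, fun u ↦ ?_, fun u v ↦ ?_, ?_⟩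
  · have hr : Measurable (fun f : Path l ↦ I.restrict (fun u ↦ f.1 u)) :=
      measurable_pi_lambda _ fun i ↦ he i
    rw [Measure.map_map hr hm]
    exact (hX.gaussian.hasGaussianLaw I).isGaussian_map
  · rw [integral_map hm.aemeasurable (he u).aestronglyMeasurable]
    exact hX.mean u
  · rw [covariance_map (he u).aestronglyMeasurable (he v).aestronglyMeasurable hm.aemeasurable]
    exact hX.covariance u v
  · exact Filter.Eventually.of_forall fun f ↦ f.2

theorem IsBridgeLaw.unique {l x y : ℝ} {W W' : Measure (Path l)} (h : IsBridgeLaw l x y W)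
    (h' : IsBridgeLaw l x y W') : W = W' := by
  have hv : W.map Subtype.val = W'.map Subtype.val := by
    have := h.gaussian.isProbabilityMeasure
    have := h'.gaussian.isProbabilityMeasure
    have e := isProjectiveLimit_map (P := W) (X := fun u (f : Path l) ↦ f.1 u)
      measurable_subtype_coe.aemeasurable
    simp_rw [IsBrownianBridge.fdd_unique h h'] at e
    exact e.unique (isProjectiveLimit_map (P := W') (X := fun u (f : Path l) ↦ f.1 u)
      measurable_subtype_coe.aemeasurable)
  ext A ⟨B, hB, hA⟩
  rw [← hA, ← Measure.map_apply measurable_subtype_coe hB, hv,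
    Measure.map_apply measurable_subtype_coe hB]

theorem IsBrownianBridge.map_eq_bridgeLaw {Ω : Type*} [MeasurableSpace Ω] {l x y : ℝ}
    {X : Set.Icc (0 : ℝ) l → Ω → ℝ} {P : Measure Ω} (hX : IsBrownianBridge 0 l x y X P)
    (hc : ∀ ω, Continuous fun u ↦ X u ω) :
    P.map (fun ω ↦ (⟨fun u ↦ X u ω, hc ω⟩ : Path l)) = bridgeLaw l x y := by
  have h : ∃ W, IsBridgeLaw l x y W := ⟨_, isBridgeLaw_map hX hc⟩
  rw [bridgeLaw, dif_pos h]
  exact (isBridgeLaw_map hX hc).unique h.choose_spec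

end BrownianLayer

end

open MeasureTheory ProbabilityTheory

noncomputable section

namespace BrownianLayer

open Set Filter Topology

section

/-! ### Gaussian processes under affine operations. -/

section GaussianProcess

variable {Ω S T : Type*} [MeasurableSpace Ω] {P : Measure Ω} {X : T → Ω → ℝ}

/-! Write `c` for the intermediate time. Regressing the bridge on its value at `c` gives `X u = N u
+ tent u * X c`, where `N` (`pinned`) is uncorrelated with `X c`, hence independent of it by joint
Gaussianity. The parts of `N` before and after `c` are independent of each other for the same
reason, and adding to each the line carrying a value `w` gives Brownian bridges from `x` to `w` and
from `w` to `y`. Freezing `X c = w` by Fubini therefore shows that, given `X c`, the path stays in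
`[L,U]` with probability equal to the product of two `gamma`s (`measureReal_restrict_stay`).

Up to a null set, the layer event is "stay in `[Ld,Uu]`" minus the union of "stay in `[Lu,Uu]`" and
"stay in `[Ld,Ud]`", and the last two intersect in "stay in `[Lu,Ud]`". Inclusion-exclusion turns
the product formula into `rho`. Integrating over `X c ∈ B` against the Gaussian law of `X c`, which
is proportional to `bridgeMarginal`, gives both the conditional probability and the density.

The null set is harmless because the extrema have no atoms. For a level `a` above both end values,
fix `N`: raising `X c` strictly raises the path at every interior time, so at most one value of `X
c` makes the maximum equal to `a`, and `X c` has no atoms. Lower levels are exceeded almost surely,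
since the bridge rises above each end value: sampled at times `s + l/(n+1)` and rescaled, it is a
driftless Gaussian random walk, which cannot stay nonpositive. The minimum follows by changing sign.
-/

theorem isGaussianProcess_linear_comb (hX : IsGaussianProcess X P) (u v : S → T) (a b : S → ℝ) :
    IsGaussianProcess (fun i ω ↦ a i * X (u i) ω + b i * X (v i) ω) P := by
  classical
  exact hX.of_isGaussianProcess fun i ↦ ⟨{u i, v i},
    { toFun z := a i * z ⟨u i, by simp⟩ + b i * z ⟨v i, by simp⟩
      map_add' z w := by simp; ring
      map_smul' c z := by simp; ring },
    fun ω ↦ by simp⟩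

theorem isGaussianProcess_add_const (hX : IsGaussianProcess X P) (c : T → ℝ) :
    IsGaussianProcess (fun i ω ↦ X i ω + c i) P := by
  refine ⟨fun I ↦ ⟨?_⟩⟩
  have h := (hX.hasGaussianLaw I).isGaussian_map
  have hm := (hX.hasGaussianLaw I).aemeasurable
  have e : P.map (fun ω ↦ I.restrict (fun i ↦ X i ω + c i)) =
      (P.map (fun ω ↦ I.restrict (X · ω))).map (fun z ↦ z + I.restrict c) := by
    rw [AEMeasurable.map_map_of_aemeasurable (by fun_prop) hm]
    rfl
  rw [e]
  infer_instance

end GaussianProcess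

variable {Ω : Type*} [MeasurableSpace Ω] {P : Measure Ω} {s t x y : ℝ} {X : Icc s t → Ω → ℝ}

/-! ### Continuous versions, symmetries and end values of the bridge. -/

namespace IsBrownianBridge

theorem isProbabilityMeasure (hX : IsBrownianBridge s t x y X P) : IsProbabilityMeasure P :=
  hX.gaussian.isProbabilityMeasure

theorem memLp (hX : IsBrownianBridge s t x y X P) (u : Icc s t) : MemLp (X u) 2 P :=
  (hX.gaussian.hasGaussianLaw_eval u).memLp_two

theorem integrable (hX : IsBrownianBridge s t x y X P) (u : Icc s t) : Integrable (X u) P :=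
  (hX.gaussian.hasGaussianLaw_eval u).integrable

/-- A Brownian bridge agrees almost surely with one all of whose paths are continuous. -/
theorem exists_continuous (hX : IsBrownianBridge s t x y X P) :
    ∃ Y : Icc s t → Ω → ℝ, IsBrownianBridge s t x y Y P ∧ (∀ ω, Continuous fun u ↦ Y u ω) ∧
      ∀ᵐ ω ∂P, ∀ u, X u ω = Y u ω := by
  classical
  have := hX.isProbabilityMeasure
  obtain ⟨G, hG, hGm, hGc⟩ :
      ∃ G ∈ ae P, MeasurableSet G ∧ ∀ ω ∈ G, Continuous fun u ↦ X u ω := by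
    -- The set of continuous paths need not be measurable in `Ω`; removing a measurable hull of its
    -- complement leaves a measurable set of full measure.
    refine ⟨(toMeasurable P {ω | Continuous fun u ↦ X u ω}ᶜ)ᶜ, ?_,
      (measurableSet_toMeasurable _ _).compl, compl_subset_comm.1 (subset_toMeasurable _ _)⟩
    rw [mem_ae_iff, compl_compl, measure_toMeasurable]
    exact hX.continuous
  have hae : ∀ᵐ ω ∂P, ∀ u, X u ω = G.indicator (X u) ω := by
    filter_upwards [hG] with ω hω u
    rw [indicator_of_mem hω]
  have hu : ∀ u, X u =ᵐ[P] G.indicator (X u) := fun u ↦ hae.mono fun ω h ↦ h u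
  refine ⟨fun u ↦ G.indicator (X u), ⟨fun u ↦ (hX.measurable u).indicator hGm,
    hX.gaussian.congr hu, fun u ↦ ?_, fun u v ↦ ?_, ?_⟩, ?_, hae⟩
  · rw [← integral_congr_ae (hu u), hX.mean]
  · rw [← hX.covariance u v, ProbabilityTheory.covariance, ProbabilityTheory.covariance,
      ← integral_congr_ae (hu u),
      ← integral_congr_ae (hu v)]
    refine integral_congr_ae ?_
    filter_upwards [hae] with ω h
    rw [h, h]
  · filter_upwards [hX.continuous, hae] with ω h1 h2
    simpa only [h2] using h1
  · intro ω
    by_cases hω : ω ∈ G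
    · simpa only [indicator_of_mem hω] using hGc ω hω
    · simpa only [indicator_of_notMem hω] using continuous_const

theorem neg (hX : IsBrownianBridge s t x y X P) :
    IsBrownianBridge s t (-x) (-y) (fun u ω ↦ -X u ω) P := by
  refine ⟨fun u ↦ (hX.measurable u).neg, ?_, fun u ↦ ?_, fun u v ↦ ?_, ?_⟩
  · simpa using hX.gaussian.smul (fun _ ↦ (-1 : ℝ))
  · rw [integral_neg, hX.mean]; ring
  · rw [covariance_fun_neg_left, covariance_fun_neg_right, hX.covariance]; ring
  · filter_upwards [hX.continuous] with ω h using h.neg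

/-- The time reversal of `[s,t]`. -/
def _root_.BrownianLayer.reflect (u : Icc s t) : Icc s t :=
  ⟨s + t - u, by linarith [u.2.2], by linarith [u.2.1]⟩

theorem reverse (hst : s < t) (hX : IsBrownianBridge s t x y X P) :
    IsBrownianBridge s t y x (fun u ↦ X (reflect u)) P := by
  have hl : t - s ≠ 0 := by linarith
  refine ⟨fun u ↦ hX.measurable _, hX.gaussian.comp_right reflect, fun u ↦ ?_, fun u v ↦ ?_, ?_⟩
  · rw [hX.mean]
    simp only [reflect]
    field_simp
    ring
  · rw [hX.covariance]
    simp only [reflect]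
    rcases le_total (u : ℝ) v with h | h
    · rw [min_eq_left h, max_eq_right h, min_eq_right (by linarith), max_eq_left (by linarith)]
      ring
    · rw [min_eq_right h, max_eq_left h, min_eq_left (by linarith), max_eq_right (by linarith)]
      ring
  · filter_upwards [hX.continuous] with ω h
    exact h.comp ((continuous_const.sub continuous_subtype_val).subtype_mk _)

theorem ae_start (hst : s < t) (hX : IsBrownianBridge s t x y X P) :
    ∀ᵐ ω ∂P, X ⟨s, le_rfl, hst.le⟩ ω = x := by
  have := hX.isProbabilityMeasure
  have hv : Var[X ⟨s, le_rfl, hst.le⟩; P] = 0 := by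
    rw [← covariance_self (hX.measurable _).aemeasurable, hX.covariance]
    simp
  -- The covariance vanishes at the end point, so the value there is its mean.
  have h := ae_eq_integral_of_variance_eq_zero (hX.memLp _) hv
  filter_upwards [h] with ω hω
  rw [hω, hX.mean]
  simp

theorem ae_end (hst : s < t) (hX : IsBrownianBridge s t x y X P) :
    ∀ᵐ ω ∂P, X ⟨t, hst.le, le_rfl⟩ ω = y := by
  have h := (hX.reverse hst).ae_start hst
  have e : (reflect ⟨s, le_rfl, hst.le⟩ : Icc s t) = ⟨t, hst.le, le_rfl⟩ := by
    ext; simp [reflect]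
  simpa only [e] using h

end IsBrownianBridge

/-! ### Decomposition of the bridge at an interior time. -/

section Pinned

/-- The value at `u` of the tent function on `[s,t]` with peak `1` at `c`. -/
def tent (s t c u : ℝ) : ℝ := (min u c - s) * (t - max u c) / ((c - s) * (t - c))

/-- The process which remains when the projection on `X c` is subtracted from `X`. -/
def pinned (X : Icc s t → Ω → ℝ) (c u : Icc s t) (ω : Ω) : ℝ := X u ω - tent s t c u * X c ω

variable {c : Icc s t}

theorem tent_pos (hs : s < c) (ht : c < t) {u : ℝ} (hsu : s < u) (hut : u < t) :
    0 < tent s t c u :=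
  div_pos (mul_pos (sub_pos.2 (lt_min hsu hs)) (sub_pos.2 (max_lt hut ht)))
    (mul_pos (sub_pos.2 hs) (sub_pos.2 ht))

theorem tent_left (hs : s < c) (ht : c < t) {u : ℝ} (h : u ≤ c) :
    tent s t c u = (u - s) / (c - s) := by
  have h1 : (c : ℝ) - s ≠ 0 := by linarith
  have h2 : t - (c : ℝ) ≠ 0 := by linarith
  rw [tent, min_eq_left h, max_eq_right h]
  field_simp

theorem tent_right (hs : s < c) (ht : c < t) {u : ℝ} (h : c ≤ u) :
    tent s t c u = (t - u) / (t - c) := by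
  have h1 : (c : ℝ) - s ≠ 0 := by linarith
  have h2 : t - (c : ℝ) ≠ 0 := by linarith
  rw [tent, min_eq_right h, max_eq_left h]
  field_simp

theorem continuous_tent (s t c : ℝ) : Continuous (tent s t c) := by
  unfold tent; fun_prop

theorem measurable_pinned (hX : IsBrownianBridge s t x y X P) (u : Icc s t) :
    Measurable (pinned X c u) :=
  (hX.measurable u).sub ((hX.measurable c).const_mul _)

theorem memLp_pinned (hX : IsBrownianBridge s t x y X P) (u : Icc s t) :
    MemLp (pinned X c u) 2 P :=
  (hX.memLp u).sub ((hX.memLp c).const_mul _)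

theorem continuous_pinned {Ω : Type*} {X : Icc s t → Ω → ℝ} {ω : Ω} (hc : Continuous fun u ↦ X u ω) :
    Continuous fun u ↦ pinned X c u ω :=
  hc.sub (((continuous_tent s t c).comp continuous_subtype_val).mul continuous_const)

/-- Joint Gaussianity is what later turns zero covariance into independence. -/
theorem isGaussianProcess_elim_pinned (hX : IsBrownianBridge s t x y X P) :
    IsGaussianProcess (Sum.elim (fun _ : Unit ↦ X c) (pinned X c)) P := by
  have h := isGaussianProcess_linear_comb hX.gaussian (S := Unit ⊕ Icc s t)
    (Sum.elim (fun _ ↦ c) id) (fun _ ↦ c) 1 (Sum.elim 0 fun u ↦ -tent s t c u)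
  refine h.congr fun i ↦ .of_forall fun ω ↦ ?_
  rcases i with i | i <;> simp [pinned]
  ring

theorem isGaussianProcess_pinned (hX : IsBrownianBridge s t x y X P) :
    IsGaussianProcess (pinned X c) P :=
  (isGaussianProcess_elim_pinned (c := c) hX).comp_right Sum.inr

/-- The tent value is exactly the regression coefficient, the covariance of `X u` and `X c` divided
by the variance of `X c`. -/
theorem covariance_pinned (hs : s < c) (ht : c < t) (hX : IsBrownianBridge s t x y X P)
    (u : Icc s t) : cov[X c, pinned X c u; P] = 0 := by
  have := hX.isProbabilityMeasure
  have h1 : (c : ℝ) - s ≠ 0 := by linarith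
  have h2 : t - (c : ℝ) ≠ 0 := by linarith
  have h3 : t - s ≠ 0 := by linarith
  unfold pinned
  rw [covariance_fun_sub_right (hX.memLp _) (hX.memLp _) ((hX.memLp _).const_mul _),
    covariance_const_mul_right, hX.covariance, hX.covariance, tent, min_self, max_self,
    min_comm, max_comm]
  field_simp
  ring

theorem covariance_pinned_pinned (hs : s < c) (ht : c < t) (hX : IsBrownianBridge s t x y X P)
    (u v : Icc s t) : cov[pinned X c u, pinned X c v; P] =
      (min (u : ℝ) v - s) * (t - max (u : ℝ) v) / (t - s)
        - tent s t c u * ((min (c : ℝ) v - s) * (t - max (c : ℝ) v) / (t - s)) := by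
  have := hX.isProbabilityMeasure
  have e : cov[pinned X c u, pinned X c v; P] =
      cov[X u, pinned X c v; P] - tent s t c u * cov[X c, pinned X c v; P] := by
    rw [← covariance_const_mul_left, ← covariance_fun_sub_left (hX.memLp _)
      ((hX.memLp _).const_mul _) (memLp_pinned hX _)]
    rfl
  rw [e, covariance_pinned hs ht hX, mul_zero, sub_zero]
  conv_lhs => unfold pinned
  rw [covariance_fun_sub_right (hX.memLp _) (hX.memLp _) ((hX.memLp _).const_mul _),
    covariance_const_mul_right, hX.covariance, hX.covariance, tent, tent, min_comm (c : ℝ),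
    max_comm (c : ℝ)]
  ring

theorem integral_pinned (hX : IsBrownianBridge s t x y X P) (u : Icc s t) :
    ∫ ω, pinned X c u ω ∂P = x + ((u : ℝ) - s) / (t - s) * (y - x)
      - tent s t c u * (x + ((c : ℝ) - s) / (t - s) * (y - x)) := by
  unfold pinned
  rw [integral_sub (hX.integrable _) ((hX.integrable _).const_mul _), integral_const_mul,
    hX.mean, hX.mean]

theorem indepFun_pinned (hs : s < c) (ht : c < t) (hX : IsBrownianBridge s t x y X P) :
    IndepFun (X c) (fun ω u ↦ pinned X c u ω) P := by
  have h := (isGaussianProcess_elim_pinned (c := c) hX).indepFun_of_covariance_eq_zero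
    (fun _ ↦ (hX.measurable c).aemeasurable) (fun u ↦ (measurable_pinned hX u).aemeasurable)
    (fun _ u ↦ covariance_pinned hs ht hX u)
  exact h.comp (φ := fun f : Unit → ℝ ↦ f ()) (ψ := id) (measurable_pi_apply _) measurable_id

variable (c) in
/-- The first half of the pinned process, on `[0,c-s]`. -/
def leftHalf (X : Icc s t → Ω → ℝ) (u : Icc (0 : ℝ) (c - s)) : Ω → ℝ :=
  pinned X c ⟨s + u, by linarith [u.2.1], by linarith [u.2.2, c.2.2]⟩

variable (c) in
/-- The second half of the pinned process, on `[0,t-c]`. -/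
def rightHalf (X : Icc s t → Ω → ℝ) (u : Icc (0 : ℝ) (t - c)) : Ω → ℝ :=
  pinned X c ⟨c + u, by linarith [u.2.1, c.2.1], by linarith [u.2.2]⟩

/-- Adding a deterministic line changes the mean only, so one process yields the bridges to all end
values `w` simultaneously. This is what allows `w` to be replaced by the random value `X c`. -/
theorem isBrownianBridge_leftHalf (hs : s < c) (ht : c < t)
    (hX : IsBrownianBridge s t x y X P) (w : ℝ) :
    IsBrownianBridge 0 (c - s) x w (fun u ω ↦ leftHalf c X u ω + u / (c - s) * w) P := by
  have := hX.isProbabilityMeasure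
  have h1 : (c : ℝ) - s ≠ 0 := by linarith
  have h2 : t - (c : ℝ) ≠ 0 := by linarith
  have h3 : t - s ≠ 0 := by linarith
  refine ⟨fun u ↦ (measurable_pinned hX _).add_const _, ?_, fun u ↦ ?_, fun u v ↦ ?_, ?_⟩
  · exact isGaussianProcess_add_const ((isGaussianProcess_pinned hX).comp_right _) _
  · simp only [leftHalf]
    rw [integral_add ((memLp_pinned hX _).integrable one_le_two) (integrable_const _),
      integral_pinned hX, tent_left hs ht (by linarith [u.2.2])]
    simp only [integral_const, probReal_univ, one_smul]
    field_simp
    ring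
  · simp only [leftHalf]
    rw [covariance_add_const_left ((memLp_pinned hX _).integrable one_le_two),
      covariance_add_const_right ((memLp_pinned hX _).integrable one_le_two),
      covariance_pinned_pinned hs ht hX, tent_left hs ht (by linarith [u.2.2]),
      min_eq_right (show s + (v : ℝ) ≤ c by linarith [v.2.2]),
      max_eq_left (show s + (v : ℝ) ≤ c by linarith [v.2.2]), min_add_add_left, max_add_add_left]
    rcases le_total (u : ℝ) v with h | h
    · rw [min_eq_left h, max_eq_right h]
      field_simp
      ring
    · rw [min_eq_right h, max_eq_left h]
      field_simp
      ring
  · filter_upwards [hX.continuous] with ω h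
    refine ((continuous_pinned h).comp (Continuous.subtype_mk ?_ _)).add ?_ <;> fun_prop

theorem isBrownianBridge_rightHalf (hs : s < c) (ht : c < t)
    (hX : IsBrownianBridge s t x y X P) (w : ℝ) :
    IsBrownianBridge 0 (t - c) w y (fun u ω ↦ rightHalf c X u ω + (1 - u / (t - c)) * w) P := by
  have := hX.isProbabilityMeasure
  have h1 : (c : ℝ) - s ≠ 0 := by linarith
  have h2 : t - (c : ℝ) ≠ 0 := by linarith
  have h3 : t - s ≠ 0 := by linarith
  refine ⟨fun u ↦ (measurable_pinned hX _).add_const _, ?_, fun u ↦ ?_, fun u v ↦ ?_, ?_⟩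
  · exact isGaussianProcess_add_const ((isGaussianProcess_pinned hX).comp_right _) _
  · simp only [rightHalf]
    rw [integral_add ((memLp_pinned hX _).integrable one_le_two) (integrable_const _),
      integral_pinned hX, tent_right hs ht (by linarith [u.2.1])]
    simp only [integral_const, probReal_univ, one_smul]
    field_simp
    ring
  · simp only [rightHalf]
    rw [covariance_add_const_left ((memLp_pinned hX _).integrable one_le_two),
      covariance_add_const_right ((memLp_pinned hX _).integrable one_le_two),
      covariance_pinned_pinned hs ht hX, tent_right hs ht (by linarith [u.2.1]),
      min_eq_left (show (c : ℝ) ≤ c + v by linarith [v.2.1]),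
      max_eq_right (show (c : ℝ) ≤ c + v by linarith [v.2.1]), min_add_add_left, max_add_add_left]
    rcases le_total (u : ℝ) v with h | h
    · rw [min_eq_left h, max_eq_right h]
      field_simp
      ring
    · rw [min_eq_right h, max_eq_left h]
      field_simp
      ring
  · filter_upwards [hX.continuous] with ω h
    refine ((continuous_pinned h).comp (Continuous.subtype_mk ?_ _)).add ?_ <;> fun_prop

/-- For `u ≤ c ≤ v` the bridge covariance factorises through `c`, so the projection on `X c` removes
all of it. -/
theorem indepFun_halves (hs : s < c) (ht : c < t) (hX : IsBrownianBridge s t x y X P) :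
    IndepFun (fun ω u ↦ leftHalf c X u ω) (fun ω u ↦ rightHalf c X u ω) P := by
  have h1 : (c : ℝ) - s ≠ 0 := by linarith
  have h2 : t - (c : ℝ) ≠ 0 := by linarith
  have h3 : t - s ≠ 0 := by linarith
  refine IsGaussianProcess.indepFun_of_covariance_eq_zero ?_
    (fun u ↦ (measurable_pinned hX _).aemeasurable)
    (fun u ↦ (measurable_pinned hX _).aemeasurable) fun u v ↦ ?_
  · have h := (isGaussianProcess_pinned (c := c) hX).comp_right
      (S := Icc (0 : ℝ) (c - s) ⊕ Icc (0 : ℝ) (t - c))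
      (Sum.elim (fun u ↦ ⟨s + u, by linarith [u.2.1], by linarith [u.2.2, c.2.2]⟩)
        (fun u ↦ ⟨c + u, by linarith [u.2.1, c.2.1], by linarith [u.2.2]⟩))
    refine h.congr fun i ↦ .of_forall fun ω ↦ ?_
    rcases i with i | i <;> rfl
  · have hu : s + (u : ℝ) ≤ c := by linarith [u.2.2]
    have hv : (c : ℝ) ≤ c + v := by linarith [v.2.1]
    rw [leftHalf, rightHalf, covariance_pinned_pinned hs ht hX, tent_left hs ht hu,
      min_eq_left hv, max_eq_right hv, min_eq_left (hu.trans hv), max_eq_right (hu.trans hv)]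
    field_simp
    ring

end Pinned

end

section

/-! ### A driftless Gaussian walk becomes positive. -/

section GaussianWalk

variable {Ω : Type*} [MeasurableSpace Ω] {P : Measure Ω}

/-- The level `R` is at most one standard deviation, which gives a tail bound uniform in `R`. -/
theorem gaussianReal_Ioi_le {R v : ℝ} (hR : 0 < R) (hv : R ^ 2 ≤ v) :
    gaussianReal 0 1 (Ioi 1) ≤ gaussianReal 0 v.toNNReal (Ioi R) := by
  have hv0 : 0 ≤ v := (sq_nonneg R).trans hv
  have e : gaussianReal 0 v.toNNReal = (gaussianReal 0 1).map (√v * ·) := by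
    rw [gaussianReal_map_const_mul, mul_zero]
    congr 1
    ext
    simp [Real.sq_sqrt hv0, hv0]
  rw [e, Measure.map_apply (by fun_prop) measurableSet_Ioi]
  have h : 0 < v := (pow_pos hR 2).trans_le hv
  refine measure_mono fun z hz ↦ ?_
  have h1 : R ≤ √v := Real.le_sqrt_of_sq_le hv
  have h2 : (1 : ℝ) < z := hz
  have h3 : 0 < √v := Real.sqrt_pos.2 h
  simp only [mem_preimage, mem_Ioi]
  nlinarith

/-- A Gaussian random walk exceeds zero almost surely. -/
theorem ae_exists_pos_of_gaussian_walk {V : ℕ → Ω → ℝ} (hV : IsGaussianProcess V P)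
    (hm : ∀ n, Measurable (V n)) {d v : ℝ} (hv : 0 < v) (hmean : ∀ n, ∫ ω, V n ω ∂P = d)
    (hcov : ∀ n m, cov[V n, V m; P] = (min n m : ℕ) * v) : ∀ᵐ ω ∂P, ∃ n, 0 < V n ω := by
  have := hV.isProbabilityMeasure
  have hLp : ∀ n, MemLp (V n) 2 P := fun n ↦ (hV.hasGaussianLaw_eval n).memLp_two
  set θ : ℝ := 1 - (gaussianReal 0 1).real (Ioi 1) with hθ
  have hθ1 : θ < 1 := by
    have : 0 < (gaussianReal 0 1).real (Ioi 1) := by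
      refine ENNReal.toReal_pos (fun h ↦ ?_) (measure_ne_top _ _)
      have := gaussianReal_absolutelyContinuous' 0 one_ne_zero h
      simp at this
    linarith
  set F : ℕ → Set Ω := fun n ↦ {ω | ∀ i ≤ n, V i ω ≤ 0} with hF
  have hFm : ∀ n, MeasurableSet (F n) := fun n ↦ by
    simp only [hF, ofPred_forall]
    exact .iInter fun i ↦ .iInter fun _ ↦ measurableSet_le (hm i) measurable_const
  have hFa : Antitone F := fun n m hnm ω h i hi ↦ h i (hi.trans hnm)
  set p := P.real (⋂ n, F n) with hp
  have tail : ∀ n, ∀ R : ℝ, 0 < R → ∃ m,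
      P.real (F n ∩ {ω | V m ω - V n ω ≤ R}) ≤ θ * P.real (F n) := by
    intro n R hR
    obtain ⟨k, hk⟩ := exists_nat_ge (R ^ 2 / v)
    rw [div_le_iff₀ hv] at hk
    refine ⟨n + k, ?_⟩
    have hG : HasGaussianLaw (fun ω ↦ V (n + k) ω - V n ω) P := hV.hasGaussianLaw_fun_sub
    have hlaw : P.map (fun ω ↦ V (n + k) ω - V n ω) = gaussianReal 0 (k * v).toNNReal := by
      rw [hG.map_eq_gaussianReal, integral_sub ((hLp _).integrable one_le_two)
        ((hLp _).integrable one_le_two), hmean, hmean, sub_self,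
        variance_fun_sub (hLp _) (hLp _), ← covariance_self (hm _).aemeasurable,
        ← covariance_self (hm _).aemeasurable, hcov, hcov, hcov]
      congr 2
      simp
      ring
    have hind : IndepFun (fun ω (i : Iic n) ↦ V i ω) (fun ω (_ : Unit) ↦ V (n + k) ω - V n ω) P := by
      refine IsGaussianProcess.indepFun_of_covariance_eq_zero ?_
        (fun i ↦ (hm _).aemeasurable) (fun _ ↦ ((hm _).sub (hm _)).aemeasurable) fun i _ ↦ ?_
      · have h := isGaussianProcess_linear_comb hV (S := Iic n ⊕ Unit)
          (Sum.elim (fun i ↦ i) fun _ ↦ n + k) (fun _ ↦ n) 1 (Sum.elim 0 fun _ ↦ -1)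
        refine h.congr fun i ↦ .of_forall fun ω ↦ ?_
        rcases i with i | i <;> simp
        ring
      · have hi : (i : ℕ) ≤ n := i.2
        rw [covariance_fun_sub_right (hLp _) (hLp _) (hLp _), hcov, hcov, min_eq_left hi,
          min_eq_left (by omega), sub_self]
    have h1 := hind.measure_inter_preimage_eq_mul {f | ∀ i, f i ≤ 0} {f | f () ≤ R}
      (by
        simp only [ofPred_forall]
        exact .iInter fun i ↦ measurableSet_le (measurable_pi_apply i) measurable_const)
      (measurableSet_le (measurable_pi_apply ()) measurable_const)
    have e1 : (fun ω (i : Iic n) ↦ V i ω) ⁻¹' {f | ∀ i, f i ≤ 0} = F n := by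
      ext ω; simp [hF]
    have e2 : (fun ω (_ : Unit) ↦ V (n + k) ω - V n ω) ⁻¹' {f | f () ≤ R} =
      {ω | V (n + k) ω - V n ω ≤ R} := rfl
    rw [e1, e2] at h1
    have h2 : P.real {ω | V (n + k) ω - V n ω ≤ R} ≤ θ := by
      have : {ω | V (n + k) ω - V n ω ≤ R} = ((fun ω ↦ V (n + k) ω - V n ω) ⁻¹' Ioi R)ᶜ := by
        ext ω; simp
      have hd : Measurable fun ω ↦ V (n + k) ω - V n ω := (hm _).sub (hm _)
      rw [this, probReal_compl_eq_one_sub (hd measurableSet_Ioi), hθ,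
        ← map_measureReal_apply hd measurableSet_Ioi, hlaw]
      have := ENNReal.toReal_mono (measure_ne_top _ _) (gaussianReal_Ioi_le hR hk)
      simp only [measureReal_def]
      linarith
    rw [measureReal_def, h1, ENNReal.toReal_mul, mul_comm]
    exact mul_le_mul_of_nonneg_right h2 ENNReal.toReal_nonneg
  -- If the walk never becomes positive, then either the increment is at most `R`, or `V n` was
  -- already below `-R`; the latter has vanishing probability as `R → ∞`. Letting `n → ∞` afterwards
  -- gives `p ≤ θ * p`, hence `p = 0`.
  have step : ∀ n, p ≤ θ * P.real (F n) := by
    intro n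
    have hlim : Tendsto (fun R : ℕ ↦ P.real {ω | V n ω ≤ -(R : ℝ)}) atTop (𝓝 0) := by
      have h := tendsto_measure_iInter_atTop (μ := P)
        (s := fun R : ℕ ↦ {ω | V n ω ≤ -(R : ℝ)})
        (fun R ↦ (measurableSet_le (hm n) measurable_const).nullMeasurableSet)
        (fun a b hab ω h ↦ by
          have : (a : ℝ) ≤ b := by exact_mod_cast hab
          simp only [mem_ofPred_eq] at h ⊢
          linarith) ⟨0, measure_ne_top _ _⟩
      have e : (⋂ R : ℕ, {ω | V n ω ≤ -(R : ℝ)}) = ∅ := by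
        refine eq_empty_of_forall_notMem fun ω hω ↦ ?_
        obtain ⟨R, hR⟩ := exists_nat_gt (-V n ω)
        have := mem_iInter.1 hω R
        simp only [mem_ofPred_eq] at this
        linarith
      rw [e, measure_empty] at h
      exact (ENNReal.tendsto_toReal ENNReal.zero_ne_top).comp h
    have h2 := hlim.const_add (θ * P.real (F n))
    rw [add_zero] at h2
    refine ge_of_tendsto h2 ?_
    filter_upwards [eventually_gt_atTop 0] with R hR
    obtain ⟨m, hmn⟩ := tail n R (by exact_mod_cast hR)
    calc p ≤ P.real (F n ∩ {ω | V m ω - V n ω ≤ R} ∪ {ω | V n ω ≤ -(R : ℝ)}) := by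
          refine measureReal_mono fun ω hω ↦ ?_
          have h := mem_iInter.1 hω
          by_cases hc : V m ω - V n ω ≤ R
          · exact .inl ⟨h n, hc⟩
          · right
            have := h m m le_rfl
            simp only [mem_ofPred_eq]
            linarith
      _ ≤ _ := (measureReal_union_le _ _).trans (by gcongr)
  have hp0 : p = 0 := by
    have h := tendsto_measure_iInter_atTop (μ := P) (s := F)
      (fun n ↦ (hFm n).nullMeasurableSet) hFa ⟨0, measure_ne_top _ _⟩
    have h' : Tendsto (fun n ↦ P.real (F n)) atTop (𝓝 p) :=
      (ENNReal.tendsto_toReal (measure_ne_top _ _)).comp h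
    have h2 := ge_of_tendsto' (h'.const_mul θ) step
    have h3 : 0 ≤ p := measureReal_nonneg
    nlinarith
  rw [hp, measureReal_eq_zero_iff] at hp0
  rw [ae_iff]
  refine measure_mono_null (fun ω hω ↦ ?_) hp0
  simp only [mem_ofPred_eq, not_exists, not_lt] at hω
  exact mem_iInter.2 fun n i _ ↦ hω i

end GaussianWalk

/-! ### Freezing one of two independent variables. -/

section Fubini

variable {Ω α β : Type*} [MeasurableSpace Ω] {P : Measure Ω} [MeasurableSpace α]
  [MeasurableSpace β]

theorem measure_prodMk_mem_of_indepFun [IsProbabilityMeasure P] {f : Ω → α} {g : Ω → β}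
    (h : IndepFun f g P) (hf : Measurable f) (hg : Measurable g) {A : Set (α × β)}
    (hA : MeasurableSet A) :
    P {ω | (f ω, g ω) ∈ A} = ∫⁻ ω', P {ω | (f ω', g ω) ∈ A} ∂P := by
  have := Measure.isProbabilityMeasure_map (μ := P) hf.aemeasurable
  have := Measure.isProbabilityMeasure_map (μ := P) hg.aemeasurable
  have e : P {ω | (f ω, g ω) ∈ A} = P.map (fun ω ↦ (f ω, g ω)) A :=
    (Measure.map_apply (hf.prodMk hg) hA).symm
  rw [e, (indepFun_iff_map_prod_eq_prod_map_map hf.aemeasurable hg.aemeasurable).1 h,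
    Measure.prod_apply hA, lintegral_map (measurable_measure_prodMk_left hA) hf]
  refine lintegral_congr fun ω' ↦ ?_
  rw [Measure.map_apply hg (measurable_prodMk_left hA)]
  rfl

end Fubini

variable {Ω : Type*} [MeasurableSpace Ω] {P : Measure Ω} {s t x y : ℝ} {X : Icc s t → Ω → ℝ}

/-! ### The bridge rises above its end values. -/

namespace IsBrownianBridge

theorem map_eval (hX : IsBrownianBridge s t x y X P) (u : Icc s t) :
    P.map (X u) = gaussianReal (x + ((u : ℝ) - s) / (t - s) * (y - x))
      (((u : ℝ) - s) * (t - u) / (t - s)).toNNReal := by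
  rw [(hX.gaussian.hasGaussianLaw_eval u).map_eq_gaussianReal, hX.mean,
    ← covariance_self (hX.measurable u).aemeasurable, hX.covariance, min_self, max_self]

/-- A Brownian bridge exceeds its initial value almost surely. -/
theorem ae_exists_start_lt (hst : s < t) (hX : IsBrownianBridge s t x y X P) :
    ∀ᵐ ω ∂P, ∃ u, x < X u ω := by
  have := hX.isProbabilityMeasure
  have hl : 0 < t - s := sub_pos.2 hst
  -- Discrete time inversion: with the weights `a n`, the values at these times form a walk of
  -- constant mean `(y - x) / (t - s)` and covariance `min n m / (t - s)`. The shift to `n + 1` puts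
  -- time `t` at index `0`, where the variance is zero.
  let u : ℕ → Icc s t := fun n ↦ ⟨s + (t - s) / (n + 1), by
    have : 0 < (t - s) / ((n : ℝ) + 1) := by positivity
    linarith, by
    have : (t - s) / ((n : ℝ) + 1) ≤ t - s := div_le_self hl.le (by linarith [n.cast_nonneg (α := ℝ)])
    linarith⟩
  have hu : ∀ n, (u n : ℝ) = s + (t - s) / (n + 1) := fun n ↦ rfl
  have hanti : ∀ {n m : ℕ}, n ≤ m → (u m : ℝ) ≤ u n := fun {n m} h ↦ by
    rw [hu, hu]
    gcongr
  let a : ℕ → ℝ := fun n ↦ ((n : ℝ) + 1) / (t - s)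
  have ha : ∀ n, 0 < a n := fun n ↦ by positivity
  let V : ℕ → Ω → ℝ := fun n ω ↦ a n * X (u n) ω + -(a n * x)
  have hV : IsGaussianProcess V P :=
    isGaussianProcess_add_const (X := fun n ω ↦ a n * X (u n) ω)
      ((hX.gaussian.comp_right u).smul a) _
  have hi : ∀ n, Integrable (fun ω ↦ a n * X (u n) ω) P := fun n ↦ (hX.integrable _).const_mul _
  have key := ae_exists_pos_of_gaussian_walk hV
    (fun n ↦ ((hX.measurable _).const_mul _).add_const _) (d := (y - x) / (t - s))
    (inv_pos.2 hl) (fun n ↦ ?_) (fun n m ↦ ?_)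
  · filter_upwards [key] with ω ⟨n, hn⟩
    refine ⟨u n, ?_⟩
    have : 0 < a n * (X (u n) ω - x) := by simp only [V] at hn; linarith
    exact sub_pos.1 (pos_of_mul_pos_right this (ha n).le)
  · simp only [V]
    rw [integral_add (hi n) (integrable_const _), integral_const_mul, hX.mean, hu]
    simp only [integral_const, probReal_univ, one_smul, a]
    field_simp
    ring
  · simp only [V]
    rw [covariance_add_const_left (hi n), covariance_add_const_right (hi m),
      covariance_const_mul_left, covariance_const_mul_right, hX.covariance]
    simp only [a]
    rcases le_total n m with h | h
    · rw [min_eq_right (hanti h), max_eq_left (hanti h), min_eq_left h, hu, hu]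
      field_simp
      ring
    · rw [min_eq_left (hanti h), max_eq_right (hanti h), min_eq_right h, hu, hu]
      field_simp
      ring

theorem ae_exists_end_lt (hst : s < t) (hX : IsBrownianBridge s t x y X P) :
    ∀ᵐ ω ∂P, ∃ u, y < X u ω := by
  filter_upwards [(hX.reverse hst).ae_exists_start_lt hst] with ω ⟨u, hu⟩
  exact ⟨_, hu⟩

end IsBrownianBridge

/-! ### The extrema of the bridge have no atoms. -/

theorem bddAbove_range_of_continuous {f : Icc s t → ℝ} (hf : Continuous f) :
    BddAbove (range f) :=
  (isCompact_range hf).bddAbove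

theorem bddBelow_range_of_continuous {f : Icc s t → ℝ} (hf : Continuous f) :
    BddBelow (range f) :=
  (isCompact_range hf).bddBelow

/-- No boundedness is needed: the real infimum is defined by reflecting the supremum, default values
included. -/
theorem pathInf_eq_neg_pathSup {T : Type*} (f : T → ℝ) :
    pathInf f = -pathSup (fun u ↦ -f u) := by
  rw [pathInf, pathSup, iInf, iSup, Real.sInf_def]
  congr 2
  ext z
  simp [neg_eq_iff_eq_neg]

/-- Reduces path conditions to countably many coordinates, making them measurable for the product
σ-algebra. -/
theorem forall_mem_iff_denseSeq {T : Type*} [TopologicalSpace T] [TopologicalSpace.SeparableSpace T]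
    [Nonempty T] {f : T → ℝ} (hf : Continuous f) {S : Set ℝ} (hS : IsClosed S) :
    (∀ u, f u ∈ S) ↔ ∀ k, f (TopologicalSpace.denseSeq T k) ∈ S := by
  refine ⟨fun h k ↦ h _, fun h u ↦ ?_⟩
  have hd := (TopologicalSpace.denseRange_denseSeq T).closure_range
  exact (hd ▸ closure_minimal (range_subset_iff.2 h) (hS.preimage hf) : univ ⊆ f ⁻¹' S)
    (mem_univ u)

namespace IsBrownianBridge

theorem ae_pathSup_ne_of_lt (hst : s < t) (hX : IsBrownianBridge s t x y X P)
    (hc : ∀ ω, Continuous fun u ↦ X u ω) {a : ℝ} (hxa : x < a) (hya : y < a) :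
    ∀ᵐ ω ∂P, pathSup (fun u ↦ X u ω) ≠ a := by
  have := hX.isProbabilityMeasure
  have : Nonempty (Icc s t) := ⟨⟨s, le_rfl, hst.le⟩⟩
  let c : Icc s t := ⟨(s + t) / 2, by linarith, by linarith⟩
  have hs : s < c := by simp only [c]; linarith
  have ht : (c : ℝ) < t := by simp only [c]; linarith
  let e := TopologicalSpace.denseSeq (Icc s t)
  -- A countable encoding of "the maximum of the path with pinned part `p.1` and value `p.2` at `c`
  -- is `a`".
  let A : Set ((Icc s t → ℝ) × ℝ) := {p | (∀ k, p.1 (e k) + tent s t c (e k) * p.2 ≤ a) ∧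
    ∀ n : ℕ, ∃ k, a - 1 / (n + 1) < p.1 (e k) + tent s t c (e k) * p.2}
  have hev : ∀ k, Measurable fun p : (Icc s t → ℝ) × ℝ ↦ p.1 (e k) + tent s t c (e k) * p.2 :=
    fun k ↦ ((measurable_pi_apply _).comp measurable_fst).add (measurable_snd.const_mul _)
  have hA : MeasurableSet A := by
    simp only [A, ofPred_and, ofPred_forall, ofPred_exists]
    exact (MeasurableSet.iInter fun k ↦ measurableSet_le (hev k) measurable_const).inter
      (.iInter fun n ↦ .iUnion fun k ↦ measurableSet_lt measurable_const (hev k))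
  have hN : Measurable (fun ω u ↦ pinned X c u ω) :=
    measurable_pi_lambda _ fun u ↦ measurable_pinned hX u
  have hsub : ∀ᵐ ω' ∂P, {g | ((fun u ↦ pinned X c u ω'), g) ∈ A}.Subsingleton := by
    filter_upwards [hX.ae_start hst, hX.ae_end hst] with ω' h0 h1
    have main : ∀ g g', ((fun u ↦ pinned X c u ω'), g) ∈ A → ((fun u ↦ pinned X c u ω'), g') ∈ A →
        ¬ g < g' := by
      intro g g' hg hg' hlt
      have hcont : ∀ b : ℝ, Continuous fun u : Icc s t ↦ pinned X c u ω' + tent s t c u * b :=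
        fun b ↦ (continuous_pinned (hc ω')).add
          (((continuous_tent s t c).comp continuous_subtype_val).mul continuous_const)
      -- At a maximiser for `g` the path reaches `a`. It is not an end point, as `x` and `y` are
      -- below `a`; so the tent is positive there, and the larger `g'` would push the path above
      -- `a`.
      obtain ⟨u, -, hu⟩ := isCompact_univ.exists_isMaxOn univ_nonempty (hcont g).continuousOn
      have hua : a ≤ pinned X c u ω' + tent s t c u * g := by
        refine le_of_forall_pos_lt_add fun ε hε ↦ ?_
        obtain ⟨n, hn⟩ := exists_nat_one_div_lt hε
        obtain ⟨k, hk⟩ := hg.2 n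
        have := hu (mem_univ (e k))
        simp only [mem_ofPred_eq] at this
        linarith
      have hu' : pinned X c u ω' + tent s t c u * g' ≤ a :=
        (forall_mem_iff_denseSeq (hcont g') isClosed_Iic).2 hg'.1 u
      rcases eq_or_lt_of_le u.2.1 with h | h
      · have : u = ⟨s, le_rfl, hst.le⟩ := Subtype.ext h.symm
        rw [this, pinned, h0, tent_left hs ht hs.le] at hua
        simp at hua
        linarith
      rcases eq_or_lt_of_le u.2.2 with h' | h'
      · have : u = ⟨t, hst.le, le_rfl⟩ := Subtype.ext h'
        rw [this, pinned, h1, tent_right hs ht ht.le] at hua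
        simp at hua
        linarith
      · have := mul_lt_mul_of_pos_left hlt (tent_pos hs ht h h')
        linarith
    intro g hg g' hg'
    exact le_antisymm (not_lt.1 (main g' g hg' hg)) (not_lt.1 (main g g' hg hg'))
  have hzero : P {ω | ((fun u ↦ pinned X c u ω), X c ω) ∈ A} = 0 := by
    rw [measure_prodMk_mem_of_indepFun (indepFun_pinned hs ht hX).symm hN (hX.measurable c) hA]
    refine (lintegral_congr_ae ?_).trans lintegral_zero
    · filter_upwards [hsub] with ω' hω'
      have hm : MeasurableSet {g | ((fun u ↦ pinned X c u ω'), g) ∈ A} := measurable_prodMk_left hA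
      have : P {ω | ((fun u ↦ pinned X c u ω'), X c ω) ∈ A} =
        P.map (X c) {g | ((fun u ↦ pinned X c u ω'), g) ∈ A} :=
        (Measure.map_apply (hX.measurable c) hm).symm
      rw [this, hX.map_eval]
      have hv : (((c : ℝ) - s) * (t - c) / (t - s)).toNNReal ≠ 0 := by
        rw [Ne, Real.toNNReal_eq_zero, not_le]
        exact div_pos (mul_pos (sub_pos.2 hs) (sub_pos.2 ht)) (sub_pos.2 hst)
      have := nullSingletonClass_gaussianReal (μ := x + ((c : ℝ) - s) / (t - s) * (y - x)) hv
      exact hω'.measure_zero _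
  rw [ae_iff]
  refine measure_mono_null (fun ω hω ↦ ?_) hzero
  simp only [ne_eq, not_not, mem_ofPred_eq] at hω
  have hdec : ∀ u, pinned X c u ω + tent s t c u * X c ω = X u ω := fun u ↦ by simp [pinned]
  refine ⟨fun k ↦ ?_, fun n ↦ ?_⟩
  · simp only [hdec]
    rw [← hω]
    exact le_ciSup (bddAbove_range_of_continuous (hc ω)) (e k)
  · simp only [hdec]
    by_contra! hn
    have := (forall_mem_iff_denseSeq (hc ω) isClosed_Iic).2 hn
    have h2 : pathSup (fun u ↦ X u ω) ≤ a - 1 / (n + 1) := ciSup_le this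
    have : (0 : ℝ) < 1 / (n + 1) := by positivity
    linarith

/-- The maximum of a Brownian bridge has no atoms. -/
theorem ae_pathSup_ne (hst : s < t) (hX : IsBrownianBridge s t x y X P) (a : ℝ) :
    ∀ᵐ ω ∂P, pathSup (fun u ↦ X u ω) ≠ a := by
  obtain ⟨Y, hY, hc, hXY⟩ := hX.exists_continuous
  suffices h : ∀ᵐ ω ∂P, pathSup (fun u ↦ Y u ω) ≠ a by
    filter_upwards [h, hXY] with ω h1 h2
    simpa only [h2] using h1
  -- Otherwise an end value is at least `a`, and the path strictly exceeds it.
  by_cases h : x < a ∧ y < a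
  · exact hY.ae_pathSup_ne_of_lt hst hc h.1 h.2
  · filter_upwards [hY.ae_exists_start_lt hst, hY.ae_exists_end_lt hst] with ω ⟨u, hu⟩ ⟨v, hv⟩ he
    have h1 := le_ciSup (bddAbove_range_of_continuous (hc ω)) u
    have h2 := le_ciSup (bddAbove_range_of_continuous (hc ω)) v
    rw [pathSup] at he
    exact h ⟨by linarith, by linarith⟩

/-- The minimum of a Brownian bridge has no atoms. -/
theorem ae_pathInf_ne (hst : s < t) (hX : IsBrownianBridge s t x y X P) (a : ℝ) :
    ∀ᵐ ω ∂P, pathInf (fun u ↦ X u ω) ≠ a := by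
  filter_upwards [hX.neg.ae_pathSup_ne hst (-a)] with ω h
  rw [pathInf_eq_neg_pathSup]
  exact fun h' ↦ h (by rw [← h', neg_neg])

end IsBrownianBridge

end

section

/-! ### Staying in an interval, and its probability. -/

section StaySet

variable {T : Type*} [TopologicalSpace T] [TopologicalSpace.SeparableSpace T] [Nonempty T]

variable (T) in
/-- The functions with values in `[L,U]` on a countable dense set. -/
def staySet (L U : ℝ) : Set (T → ℝ) := {f | ∀ k, f (TopologicalSpace.denseSeq T k) ∈ Icc L U}

theorem measurableSet_staySet (L U : ℝ) : MeasurableSet (staySet T L U) := by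
  simp only [staySet, ofPred_forall]
  exact .iInter fun k ↦ measurable_pi_apply _ measurableSet_Icc

theorem mem_staySet_iff {f : T → ℝ} (hf : Continuous f) {L U : ℝ} :
    f ∈ staySet T L U ↔ ∀ u, f u ∈ Icc L U :=
  (forall_mem_iff_denseSeq hf isClosed_Icc).symm

theorem staySet_mono {L L' U U' : ℝ} (hL : L' ≤ L) (hU : U ≤ U') :
    staySet T L U ⊆ staySet T L' U' :=
  fun _ h k ↦ Icc_subset_Icc hL hU (h k)

theorem staySet_inter {L L' U U' : ℝ} (hL : L' ≤ L) (hU : U' ≤ U) :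
    staySet T L U ∩ staySet T L' U' = staySet T L U' :=
  Subset.antisymm (fun _ h k ↦ ⟨(h.1 k).1, (h.2 k).2⟩)
    fun _ h ↦ ⟨staySet_mono le_rfl hU h, staySet_mono hL le_rfl h⟩

end StaySet

theorem mem_staySet_iff_pathInf_pathSup {s t : ℝ} [Nonempty (Icc s t)] {f : Icc s t → ℝ}
    (hf : Continuous f) {L U : ℝ} :
    f ∈ staySet (Icc s t) L U ↔ L ≤ pathInf f ∧ pathSup f ≤ U := by
  rw [mem_staySet_iff hf, pathInf, pathSup, le_ciInf_iff (bddBelow_range_of_continuous hf),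
    ciSup_le_iff (bddAbove_range_of_continuous hf)]
  exact forall_and

/-- Inclusion-exclusion; the source of the four signed terms of `rho`. -/
theorem measureReal_sdiff_union {α : Type*} [MeasurableSpace α] {μ : Measure α} [IsFiniteMeasure μ]
    {A B C : Set α} (hBA : B ⊆ A) (hCA : C ⊆ A) (hB : MeasurableSet B) (hC : MeasurableSet C) :
    μ.real (A \ (B ∪ C)) = μ.real A - μ.real B - μ.real C + μ.real (B ∩ C) := by
  rw [measureReal_sdiff (union_subset hBA hCA) (hB.union hC)]
  linarith [measureReal_union_add_inter (μ := μ) (s := B) hC]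

variable {Ω : Type*} [MeasurableSpace Ω] {P : Measure Ω}

/-- The probability that a Brownian bridge stays in `[L,U]` is given by `gamma`. -/
theorem gamma_eq_measureReal {k a b L U : ℝ} [Nonempty (Icc 0 k)] {Y : Icc (0 : ℝ) k → Ω → ℝ}
    (hY : IsBrownianBridge 0 k a b Y P) (hc : ∀ ω, Continuous fun u ↦ Y u ω) :
    gamma L U k a b = P.real {ω | (fun u ↦ Y u ω) ∈ staySet (Icc 0 k) L U} := by
  have := hY.isProbabilityMeasure
  have hm := measurable_path hY.measurable hc
  have hS : MeasurableSet {f : Path k | f.1 ∈ staySet (Icc 0 k) L U} :=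
    measurable_subtype_coe (measurableSet_staySet L U)
  have e : {f : Path k | pathInf f.1 < L ∨ U < pathSup f.1} =
      {f : Path k | f.1 ∈ staySet (Icc 0 k) L U}ᶜ := by
    ext f
    simp only [mem_compl_iff, mem_ofPred_eq, mem_staySet_iff_pathInf_pathSup f.2, not_and_or,
      not_le]
  rw [gamma, zeta, ← hY.map_eq_bridgeLaw hc, e, map_measureReal_apply hm hS.compl,
    preimage_compl, probReal_compl_eq_one_sub (hm hS)]
  exact sub_sub_cancel _ _

theorem gamma_mem_Icc {k a b : ℝ} (hk : 0 < k) {Y : Icc (0 : ℝ) k → Ω → ℝ}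
    (hY : IsBrownianBridge 0 k a b Y P) (hc : ∀ ω, Continuous fun u ↦ Y u ω) (L U : ℝ) :
    gamma L U k a b ∈ Icc 0 1 := by
  have := hY.isProbabilityMeasure
  have : Nonempty (Icc 0 k) := ⟨⟨0, le_rfl, hk.le⟩⟩
  rw [gamma_eq_measureReal hY hc]
  exact ⟨measureReal_nonneg, measureReal_le_one⟩

/-! ### The Markov property at time `c`. -/

variable {s t x y : ℝ} {X : Icc s t → Ω → ℝ} {c : Icc s t}

theorem continuous_leftHalf {Ω : Type*} {X : Icc s t → Ω → ℝ} {ω : Ω}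
    (hc : Continuous fun u ↦ X u ω) (w : ℝ) :
    Continuous fun u : Icc (0 : ℝ) (c - s) ↦ leftHalf c X u ω + u / (c - s) * w := by
  refine ((continuous_pinned hc).comp (Continuous.subtype_mk ?_ _)).add ?_ <;> fun_prop

theorem continuous_rightHalf {Ω : Type*} {X : Icc s t → Ω → ℝ} {ω : Ω}
    (hc : Continuous fun u ↦ X u ω) (w : ℝ) :
    Continuous fun u : Icc (0 : ℝ) (t - c) ↦ rightHalf c X u ω + (1 - u / (t - c)) * w := by
  refine ((continuous_pinned hc).comp (Continuous.subtype_mk ?_ _)).add ?_ <;> fun_prop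

theorem measurable_leftHalf (hX : IsBrownianBridge s t x y X P) :
    Measurable fun ω u ↦ leftHalf c X u ω :=
  measurable_pi_lambda _ fun _ ↦ measurable_pinned hX _

theorem measurable_rightHalf (hX : IsBrownianBridge s t x y X P) :
    Measurable fun ω u ↦ rightHalf c X u ω :=
  measurable_pi_lambda _ fun _ ↦ measurable_pinned hX _

/-- The pairs of a number `w` and a function `f` on `[0,c-s]` for which `f` plus the line from `0`
to `w` is in `staySet`. -/
def leftStay (c : Icc s t) [Nonempty (Icc 0 (c - s))] (L U : ℝ) :
    Set (ℝ × (Icc (0 : ℝ) (c - s) → ℝ)) :=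
  {p | (fun u ↦ p.2 u + u / (c - s) * p.1) ∈ staySet (Icc (0 : ℝ) (c - s)) L U}

/-- The pairs of a number `w` and a function `f` on `[0,t-c]` for which `f` plus the line from `w`
to `0` is in `staySet`. -/
def rightStay (c : Icc s t) [Nonempty (Icc 0 (t - c))] (L U : ℝ) :
    Set (ℝ × (Icc (0 : ℝ) (t - c) → ℝ)) :=
  {p | (fun u ↦ p.2 u + (1 - u / (t - c)) * p.1) ∈ staySet (Icc (0 : ℝ) (t - c)) L U}

theorem leftStay_mono [Nonempty (Icc 0 (c - s))] {L L' U U' : ℝ} (hL : L' ≤ L) (hU : U ≤ U') :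
    leftStay c L U ⊆ leftStay c L' U' := by
  intro p h
  rw [leftStay, mem_ofPred_eq] at h ⊢
  exact staySet_mono hL hU h

theorem rightStay_mono [Nonempty (Icc 0 (t - c))] {L L' U U' : ℝ} (hL : L' ≤ L) (hU : U ≤ U') :
    rightStay c L U ⊆ rightStay c L' U' := by
  intro p h
  rw [rightStay, mem_ofPred_eq] at h ⊢
  exact staySet_mono hL hU h

theorem leftStay_inter_subset [Nonempty (Icc 0 (c - s))] {L L' U U' : ℝ} (hL : L' ≤ L)
    (hU : U' ≤ U) : leftStay c L U ∩ leftStay c L' U' ⊆ leftStay c L U' := by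
  intro p h
  rw [leftStay, leftStay, mem_inter_iff, mem_ofPred_eq, mem_ofPred_eq] at h
  rw [leftStay, mem_ofPred_eq, ← staySet_inter hL hU]
  exact h

theorem rightStay_inter_subset [Nonempty (Icc 0 (t - c))] {L L' U U' : ℝ} (hL : L' ≤ L)
    (hU : U' ≤ U) : rightStay c L U ∩ rightStay c L' U' ⊆ rightStay c L U' := by
  intro p h
  rw [rightStay, rightStay, mem_inter_iff, mem_ofPred_eq, mem_ofPred_eq] at h
  rw [rightStay, mem_ofPred_eq, ← staySet_inter hL hU]
  exact h

theorem measurableSet_leftStay [Nonempty (Icc 0 (c - s))] (L U : ℝ) :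
    MeasurableSet (leftStay c L U) := by
  have h : Measurable fun (p : ℝ × (Icc (0 : ℝ) (c - s) → ℝ)) (u : Icc (0 : ℝ) (c - s)) ↦
      p.2 u + u / (c - s) * p.1 := by
    fun_prop
  exact h (measurableSet_staySet L U)

theorem measurableSet_rightStay [Nonempty (Icc 0 (t - c))] (L U : ℝ) :
    MeasurableSet (rightStay c L U) := by
  have h : Measurable fun (p : ℝ × (Icc (0 : ℝ) (t - c) → ℝ)) (u : Icc (0 : ℝ) (t - c)) ↦
      p.2 u + (1 - u / (t - c)) * p.1 := by
    fun_prop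
  exact h (measurableSet_staySet L U)

theorem gamma_left (hs : s < c) (ht : c < t) [Nonempty (Icc 0 (c - s))]
    (hX : IsBrownianBridge s t x y X P) (hc : ∀ ω, Continuous fun u ↦ X u ω) (L U w : ℝ) :
    gamma L U (c - s) x w = P.real {ω | (w, fun u ↦ leftHalf c X u ω) ∈ leftStay c L U} :=
  gamma_eq_measureReal (isBrownianBridge_leftHalf hs ht hX w) fun ω ↦ continuous_leftHalf (hc ω) w

theorem gamma_right (hs : s < c) (ht : c < t) [Nonempty (Icc 0 (t - c))]
    (hX : IsBrownianBridge s t x y X P) (hc : ∀ ω, Continuous fun u ↦ X u ω) (L U w : ℝ) :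
    gamma L U (t - c) w y = P.real {ω | (w, fun u ↦ rightHalf c X u ω) ∈ rightStay c L U} :=
  gamma_eq_measureReal (isBrownianBridge_rightHalf hs ht hX w)
    fun ω ↦ continuous_rightHalf (hc ω) w

/-- Because one process realises the bridges for all `w`, this is the measure of the sections of a
single measurable set in `ℝ × Ω`. -/
theorem measurable_gamma_left (hs : s < c) (ht : c < t) (hX : IsBrownianBridge s t x y X P)
    (hc : ∀ ω, Continuous fun u ↦ X u ω) (L U : ℝ) : Measurable (gamma L U (c - s) x) := by
  have := hX.isProbabilityMeasure
  have : Nonempty (Icc 0 (c - s)) := ⟨⟨0, le_rfl, by linarith⟩⟩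
  have h : MeasurableSet {p : ℝ × Ω | (p.1, fun u ↦ leftHalf c X u p.2) ∈ leftStay c L U} :=
    (measurable_fst.prodMk ((measurable_leftHalf hX).comp measurable_snd))
      (measurableSet_leftStay L U)
  rw [show gamma L U (c - s) x = _ from funext (gamma_left hs ht hX hc L U)]
  exact (measurable_measure_prodMk_left (ν := P) h).ennreal_toReal

theorem measurable_gamma_right (hs : s < c) (ht : c < t) (hX : IsBrownianBridge s t x y X P)
    (hc : ∀ ω, Continuous fun u ↦ X u ω) (L U : ℝ) :
    Measurable fun w ↦ gamma L U (t - c) w y := by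
  have := hX.isProbabilityMeasure
  have : Nonempty (Icc 0 (t - c)) := ⟨⟨0, le_rfl, by linarith⟩⟩
  have h : MeasurableSet {p : ℝ × Ω | (p.1, fun u ↦ rightHalf c X u p.2) ∈ rightStay c L U} :=
    (measurable_fst.prodMk ((measurable_rightHalf hX).comp measurable_snd))
      (measurableSet_rightStay L U)
  rw [show (fun w ↦ gamma L U (t - c) w y) = _ from funext (gamma_right hs ht hX hc L U)]
  exact (measurable_measure_prodMk_left (ν := P) h).ennreal_toReal

/-- A path stays in `[L,U]` if and only if both of its halves do. -/
theorem mem_staySet_iff_halves [Nonempty (Icc s t)] [Nonempty (Icc 0 (c - s))]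
    [Nonempty (Icc 0 (t - c))] (hs : s < c) (ht : c < t) {Ω : Type*} {X : Icc s t → Ω → ℝ} {ω : Ω}
    (hc : Continuous fun u ↦ X u ω) {L U : ℝ} :
    (fun u ↦ X u ω) ∈ staySet (Icc s t) L U ↔
      (X c ω, fun u ↦ leftHalf c X u ω) ∈ leftStay c L U ∧
        (X c ω, fun u ↦ rightHalf c X u ω) ∈ rightStay c L U := by
  have h1 : (c : ℝ) - s ≠ 0 := by linarith
  have h2 : t - (c : ℝ) ≠ 0 := by linarith
  have hl : ∀ u : Icc (0 : ℝ) (c - s), leftHalf c X u ω + u / (c - s) * X c ω =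
      X ⟨s + u, by linarith [u.2.1], by linarith [u.2.2, c.2.2]⟩ ω := fun u ↦ by
    rw [leftHalf, pinned, tent_left hs ht (by linarith [u.2.2])]
    simp
  have hr : ∀ u : Icc (0 : ℝ) (t - c), rightHalf c X u ω + (1 - u / (t - c)) * X c ω =
      X ⟨c + u, by linarith [u.2.1, c.2.1], by linarith [u.2.2]⟩ ω := fun u ↦ by
    rw [rightHalf, pinned, tent_right hs ht (by linarith [u.2.1])]
    field_simp
    ring
  rw [mem_staySet_iff hc, leftStay, rightStay, mem_ofPred_eq, mem_ofPred_eq,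
    mem_staySet_iff (continuous_leftHalf hc _), mem_staySet_iff (continuous_rightHalf hc _)]
  simp only [hl, hr]
  refine ⟨fun h ↦ ⟨fun u ↦ h _, fun u ↦ h _⟩, fun h u ↦ ?_⟩
  rcases le_total u c with hu | hu
  · have hu' : (u : ℝ) ≤ c := hu
    have := h.1 ⟨u - s, by linarith [u.2.1], by linarith⟩
    simpa using this
  · have hu' : (c : ℝ) ≤ u := hu
    have := h.2 ⟨u - c, by linarith, by linarith [u.2.2]⟩
    simpa using this

/-- The Markov property of the Brownian bridge, for the event that it stays in `[L,U]`. -/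
theorem measureReal_restrict_stay (hs : s < c) (ht : c < t) [Nonempty (Icc s t)]
    (hX : IsBrownianBridge s t x y X P) (hc : ∀ ω, Continuous fun u ↦ X u ω) (L U : ℝ)
    {B : Set ℝ} (hB : MeasurableSet B) :
    (P.restrict (X c ⁻¹' B)).real {ω | (fun u ↦ X u ω) ∈ staySet (Icc s t) L U} =
      ∫ ω in X c ⁻¹' B, gamma L U (c - s) x (X c ω) * gamma L U (t - c) (X c ω) y ∂P := by
  have := hX.isProbabilityMeasure
  have hne1 : Nonempty (Icc 0 (c - s)) := ⟨⟨0, le_rfl, by linarith⟩⟩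
  have hne2 : Nonempty (Icc 0 (t - c)) := ⟨⟨0, le_rfl, by linarith⟩⟩
  have hmX : Measurable fun ω u ↦ X u ω := measurable_pi_lambda _ hX.measurable
  let A : Set (ℝ × (Icc (0 : ℝ) (c - s) → ℝ) × (Icc (0 : ℝ) (t - c) → ℝ)) :=
    {p | p.1 ∈ B ∧ (p.1, p.2.1) ∈ leftStay c L U ∧ (p.1, p.2.2) ∈ rightStay c L U}
  have hA : MeasurableSet A := by
    refine (measurable_fst hB).inter (MeasurableSet.inter ?_ ?_)
    · exact (measurable_fst.prodMk (measurable_fst.comp measurable_snd))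
        (measurableSet_leftStay L U)
    · exact (measurable_fst.prodMk (measurable_snd.comp measurable_snd))
        (measurableSet_rightStay L U)
  have hind : IndepFun (X c)
      (fun ω ↦ ((fun u ↦ leftHalf c X u ω), fun u ↦ rightHalf c X u ω)) P := by
    let ψ : (Icc s t → ℝ) → (Icc (0 : ℝ) (c - s) → ℝ) × (Icc (0 : ℝ) (t - c) → ℝ) := fun f ↦
      (fun u ↦ f ⟨s + u, by linarith [u.2.1], by linarith [u.2.2, c.2.2]⟩,
        fun u ↦ f ⟨c + u, by linarith [u.2.1, c.2.1], by linarith [u.2.2]⟩)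
    exact (indepFun_pinned hs ht hX).comp (φ := id) (ψ := ψ) measurable_id (by fun_prop)
  -- With `X c` frozen at `w`, independence of the halves produces the product of the two staying
  -- probabilities.
  have hsec : ∀ w, P {ω | (w, fun u ↦ leftHalf c X u ω) ∈ leftStay c L U ∧
      (w, fun u ↦ rightHalf c X u ω) ∈ rightStay c L U} =
      ENNReal.ofReal (gamma L U (c - s) x w * gamma L U (t - c) w y) := fun w ↦ by
    have h := (indepFun_halves hs ht hX).measure_inter_preimage_eq_mul
      {f | (w, f) ∈ leftStay c L U} {f | (w, f) ∈ rightStay c L U}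
      (measurable_prodMk_left (measurableSet_leftStay L U))
      (measurable_prodMk_left (measurableSet_rightStay L U))
    rw [gamma_left hs ht hX hc, gamma_right hs ht hX hc, measureReal_def, measureReal_def,
      ← ENNReal.toReal_mul, ENNReal.ofReal_toReal (by finiteness)]
    exact h
  have hnn : ∀ w, 0 ≤ gamma L U (c - s) x w * gamma L U (t - c) w y := fun w ↦ by
    rw [gamma_left hs ht hX hc, gamma_right hs ht hX hc]
    exact mul_nonneg measureReal_nonneg measureReal_nonneg
  have hmeas : Measurable fun w ↦ gamma L U (c - s) x w * gamma L U (t - c) w y :=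
    (measurable_gamma_left hs ht hX hc L U).mul (measurable_gamma_right hs ht hX hc L U)
  have hS : MeasurableSet {ω | (fun u ↦ X u ω) ∈ staySet (Icc s t) L U} :=
    hmX (measurableSet_staySet L U)
  rw [measureReal_restrict_apply hS,
    integral_eq_lintegral_of_nonneg_ae (.of_forall fun ω ↦ hnn _)
      (hmeas.comp (hX.measurable c)).aestronglyMeasurable, measureReal_def]
  congr 1
  have e : {ω | (fun u ↦ X u ω) ∈ staySet (Icc s t) L U} ∩ X c ⁻¹' B =
      {ω | (X c ω, (fun u ↦ leftHalf c X u ω), fun u ↦ rightHalf c X u ω) ∈ A} := by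
    ext ω
    simp only [A, mem_inter_iff, mem_ofPred_eq, mem_staySet_iff_halves hs ht (hc ω), mem_preimage]
    tauto
  rw [e, measure_prodMk_mem_of_indepFun hind (hX.measurable c)
    ((measurable_leftHalf hX).prodMk (measurable_rightHalf hX)) hA,
    ← lintegral_indicator (hX.measurable c hB)]
  refine lintegral_congr fun ω' ↦ ?_
  by_cases h : X c ω' ∈ B
  · rw [indicator_of_mem (show ω' ∈ X c ⁻¹' B from h), ← hsec]
    simp only [A, mem_ofPred_eq, h, true_and]
  · rw [indicator_of_notMem (show ω' ∉ X c ⁻¹' B from h)]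
    simp [A, h]

/-! ### The layer event and `rho`. -/

section Rho

variable {Ld Lu Ud Uu : ℝ}

/-- Each product of `gamma`s is the measure of a rectangle in `Ω × Ω`, so `rho` is the measure of a
set difference. This gives the sign for every `w`, not only almost every `w`. -/
theorem rho_nonneg (hs : s < c) (ht : c < t) (hX : IsBrownianBridge s t x y X P)
    (hc : ∀ ω, Continuous fun u ↦ X u ω) (hL : Ld ≤ Lu) (hU : Ud ≤ Uu) (w : ℝ) :
    0 ≤ rho Ld Lu Ud Uu (c - s) (t - c) x w y := by
  have := hX.isProbabilityMeasure
  have hne1 : Nonempty (Icc 0 (c - s)) := ⟨⟨0, le_rfl, by linarith⟩⟩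
  have hne2 : Nonempty (Icc 0 (t - c)) := ⟨⟨0, le_rfl, by linarith⟩⟩
  let R : ℝ → ℝ → Set (Ω × Ω) := fun L U ↦
    {ω | (w, fun u ↦ leftHalf c X u ω) ∈ leftStay c L U} ×ˢ
      {ω | (w, fun u ↦ rightHalf c X u ω) ∈ rightStay c L U}
  have hR : ∀ L U, MeasurableSet (R L U) := fun L U ↦
    MeasurableSet.prod
      ((measurable_const.prodMk (measurable_leftHalf hX)) (measurableSet_leftStay L U))
      ((measurable_const.prodMk (measurable_rightHalf hX)) (measurableSet_rightStay L U))
  have hmul : ∀ L U, gamma L U (c - s) x w * gamma L U (t - c) w y = (P.prod P).real (R L U) :=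
    fun L U ↦ by rw [gamma_left hs ht hX hc, gamma_right hs ht hX hc, measureReal_prod_prod]
  have hmono : ∀ {L L' U U' : ℝ}, L' ≤ L → U ≤ U' → R L U ⊆ R L' U' := fun hL hU ↦
    prod_mono (fun _ h ↦ leftStay_mono hL hU h) fun _ h ↦ rightStay_mono hL hU h
  have hinter : R Lu Uu ∩ R Ld Ud = R Lu Ud :=
    Subset.antisymm
      (fun p hp ↦ ⟨leftStay_inter_subset hL hU ⟨hp.1.1, hp.2.1⟩,
        rightStay_inter_subset hL hU ⟨hp.1.2, hp.2.2⟩⟩)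
      (subset_inter (hmono le_rfl hU) (hmono hL le_rfl))
  rw [rho, hmul, hmul, hmul, hmul, ← hinter,
    ← measureReal_sdiff_union (hmono hL le_rfl) (hmono le_rfl hU) (hR _ _) (hR _ _)]
  exact measureReal_nonneg

theorem measurable_rho (hs : s < c) (ht : c < t) (hX : IsBrownianBridge s t x y X P)
    (hc : ∀ ω, Continuous fun u ↦ X u ω) :
    Measurable fun w ↦ rho Ld Lu Ud Uu (c - s) (t - c) x w y := by
  have h : ∀ L U, Measurable fun w ↦ gamma L U (c - s) x w * gamma L U (t - c) w y := fun L U ↦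
    (measurable_gamma_left hs ht hX hc L U).mul (measurable_gamma_right hs ht hX hc L U)
  exact (((h _ _).sub (h _ _)).sub (h _ _)).add (h _ _)

theorem gamma_mul_gamma_mem_Icc (hs : s < c) (ht : c < t) (hX : IsBrownianBridge s t x y X P)
    (hc : ∀ ω, Continuous fun u ↦ X u ω) (L U w : ℝ) :
    gamma L U (c - s) x w * gamma L U (t - c) w y ∈ Icc 0 1 := by
  have h1 := gamma_mem_Icc (by linarith) (isBrownianBridge_leftHalf hs ht hX w)
    (fun ω ↦ continuous_leftHalf (hc ω) w) L U
  have h2 := gamma_mem_Icc (by linarith) (isBrownianBridge_rightHalf hs ht hX w)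
    (fun ω ↦ continuous_rightHalf (hc ω) w) L U
  exact ⟨mul_nonneg h1.1 h2.1, mul_le_one₀ h1.2 h2.1 h2.2⟩

theorem abs_rho_le (hs : s < c) (ht : c < t) (hX : IsBrownianBridge s t x y X P)
    (hc : ∀ ω, Continuous fun u ↦ X u ω) (w : ℝ) :
    |rho Ld Lu Ud Uu (c - s) (t - c) x w y| ≤ 2 := by
  have h := gamma_mul_gamma_mem_Icc hs ht hX hc
  have h1 := h Ld Uu w
  have h2 := h Lu Uu w
  have h3 := h Ld Ud w
  have h4 := h Lu Ud w
  rw [rho, abs_le]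
  constructor <;> linarith [h1.1, h1.2, h2.1, h2.2, h3.1, h3.2, h4.1, h4.2]

/-- The layer event in terms of the events that the path stays in an interval. -/
theorem layerEvent_ae_eq [Nonempty (Icc s t)] (hst : s < t) (hX : IsBrownianBridge s t x y X P)
    (hc : ∀ ω, Continuous fun u ↦ X u ω) :
    layerEvent X Ld Lu Ud Uu =ᵐ[P] ({ω | (fun u ↦ X u ω) ∈ staySet (Icc s t) Ld Uu} \
      ({ω | (fun u ↦ X u ω) ∈ staySet (Icc s t) Lu Uu} ∪
        {ω | (fun u ↦ X u ω) ∈ staySet (Icc s t) Ld Ud}) : Set Ω) := by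
  rw [eventuallyEq_set]
  -- Only the inner levels matter: removing the smaller events gives strict inequalities at `Lu` and
  -- `Ud`, while those at `Ld` and `Uu` are weak on both sides.
  filter_upwards [hX.ae_pathInf_ne hst Lu, hX.ae_pathSup_ne hst Ud] with ω h1 h2
  simp only [layerEvent, Set.mem_sdiff, mem_union, mem_ofPred_eq,
    mem_staySet_iff_pathInf_pathSup (hc ω), mem_Icc]
  have h1' := h1.le_iff_lt
  have h2' := h2.symm.le_iff_lt
  rw [h1', h2', ← not_le, ← not_le]
  tauto

/-- Paths are only almost surely continuous, so the extrema over uncountably many times need not be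
measurable. -/
theorem nullMeasurableSet_layerEvent (hst : s < t) (hX : IsBrownianBridge s t x y X P) :
    NullMeasurableSet (layerEvent X Ld Lu Ud Uu) P := by
  obtain ⟨Y, hY, hc, hXY⟩ := hX.exists_continuous
  have : Nonempty (Icc s t) := ⟨⟨s, le_rfl, hst.le⟩⟩
  have hm : Measurable fun ω u ↦ Y u ω := measurable_pi_lambda _ hY.measurable
  have hS : ∀ L U, MeasurableSet {ω | (fun u ↦ Y u ω) ∈ staySet (Icc s t) L U} := fun L U ↦
    hm (measurableSet_staySet L U)
  have e : layerEvent X Ld Lu Ud Uu =ᵐ[P] layerEvent Y Ld Lu Ud Uu := by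
    rw [eventuallyEq_set]
    filter_upwards [hXY] with ω h
    simp only [layerEvent, mem_ofPred_eq, h]
  exact ((((hS _ _).diff ((hS _ _).union (hS _ _))).nullMeasurableSet).congr
    (layerEvent_ae_eq hst hY hc).symm).congr e.symm

/-- The conditional probability of the layer event given the value at time `c`. -/
theorem measureReal_restrict_layerEvent (hs : s < c) (ht : c < t)
    (hX : IsBrownianBridge s t x y X P) (hL : Ld ≤ Lu) (hU : Ud ≤ Uu) {B : Set ℝ}
    (hB : MeasurableSet B) :
    (P.restrict (X c ⁻¹' B)).real (layerEvent X Ld Lu Ud Uu) =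
      ∫ ω in X c ⁻¹' B, rho Ld Lu Ud Uu (c - s) (t - c) x (X c ω) y ∂P := by
  have := hX.isProbabilityMeasure
  obtain ⟨Y, hY, hc, hXY⟩ := hX.exists_continuous
  have hst := hs.trans ht
  have : Nonempty (Icc s t) := ⟨⟨s, le_rfl, hst.le⟩⟩
  have hm : Measurable fun ω u ↦ Y u ω := measurable_pi_lambda _ hY.measurable
  have hS : ∀ L U, MeasurableSet {ω | (fun u ↦ Y u ω) ∈ staySet (Icc s t) L U} := fun L U ↦
    hm (measurableSet_staySet L U)
  have e : layerEvent X Ld Lu Ud Uu =ᵐ[P] layerEvent Y Ld Lu Ud Uu := by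
    rw [eventuallyEq_set]
    filter_upwards [hXY] with ω h
    simp only [layerEvent, mem_ofPred_eq, h]
  have eB : (X c ⁻¹' B : Set Ω) =ᵐ[P] Y c ⁻¹' B := by
    rw [eventuallyEq_set]
    filter_upwards [hXY] with ω h
    rw [mem_preimage, mem_preimage, h]
  have hR : ∀ L U, Integrable (fun ω ↦ gamma L U (c - s) x (Y c ω) * gamma L U (t - c) (Y c ω) y)
      (P.restrict (Y c ⁻¹' B)) := fun L U ↦ by
    refine Integrable.of_bound (C := 1) ?_ (.of_forall fun ω ↦ ?_)
    · exact (((measurable_gamma_left hs ht hY hc L U).mul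
        (measurable_gamma_right hs ht hY hc L U)).comp (hY.measurable c)).aestronglyMeasurable
    · have h := gamma_mul_gamma_mem_Icc hs ht hY hc L U (Y c ω)
      rw [Real.norm_of_nonneg h.1]
      exact h.2
  have e1 : ∫ ω in X c ⁻¹' B, rho Ld Lu Ud Uu (c - s) (t - c) x (X c ω) y ∂P =
      ∫ ω in Y c ⁻¹' B, rho Ld Lu Ud Uu (c - s) (t - c) x (Y c ω) y ∂P := by
    rw [Measure.restrict_congr_set eB]
    refine integral_congr_ae (ae_restrict_of_ae ?_)
    filter_upwards [hXY] with ω h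
    rw [h]
  rw [e1, Measure.restrict_congr_set eB, measureReal_congr (ae_restrict_of_ae
    (e.trans (layerEvent_ae_eq hst hY hc)))]
  have hmono : ∀ {L L' U U' : ℝ}, L' ≤ L → U ≤ U' →
      {ω | (fun u ↦ Y u ω) ∈ staySet (Icc s t) L U} ⊆
        {ω | (fun u ↦ Y u ω) ∈ staySet (Icc s t) L' U'} :=
    fun hL hU ↦ preimage_mono (f := fun ω u ↦ Y u ω) (staySet_mono hL hU)
  rw [measureReal_sdiff_union (hmono hL le_rfl) (hmono le_rfl hU) (hS _ _) (hS _ _)]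
  have hinter : {ω | (fun u ↦ Y u ω) ∈ staySet (Icc s t) Lu Uu} ∩
      {ω | (fun u ↦ Y u ω) ∈ staySet (Icc s t) Ld Ud} =
      {ω | (fun u ↦ Y u ω) ∈ staySet (Icc s t) Lu Ud} := by
    rw [← staySet_inter hL hU]; rfl
  rw [hinter, measureReal_restrict_stay hs ht hY hc _ _ hB,
    measureReal_restrict_stay hs ht hY hc _ _ hB, measureReal_restrict_stay hs ht hY hc _ _ hB,
    measureReal_restrict_stay hs ht hY hc _ _ hB]
  simp only [rho]
  rw [← integral_sub' (hR _ _) (hR _ _), ← integral_sub' ((hR _ _).sub (hR _ _)) (hR _ _),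
    ← integral_add' (((hR _ _).sub (hR _ _)).sub (hR _ _)) (hR _ _)]
  rfl

end Rho

end

/-! ### The conditional probability and the conditional density. -/

section

variable {Ω : Type*} [MeasurableSpace Ω] {P : Measure Ω} {s t x y : ℝ} {X : Icc s t → Ω → ℝ}
  {c : Icc s t} {Ld Lu Ud Uu : ℝ}

/-- The density of `X c` is proportional to `bridgeMarginal`. -/
theorem bridgeMarginal_eq (hs : s < c) (ht : c < t) (x y : ℝ) : ∃ C : ℝ, 0 < C ∧
    ∀ w, bridgeMarginal (c - s) (t - c) x y w =
      C * gaussianPDFReal (x + ((c : ℝ) - s) / (t - s) * (y - x))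
        (((c : ℝ) - s) * (t - c) / (t - s)).toNNReal w := by
  have h1 : 0 < (c : ℝ) - s := by linarith
  have h2 : 0 < t - (c : ℝ) := by linarith
  have h3 : 0 < t - s := by linarith
  have hv : 0 < ((c : ℝ) - s) * (t - c) / (t - s) := by positivity
  -- The Gaussian normalising factor for the variance of `X c`.
  refine ⟨√(2 * Real.pi * (((c : ℝ) - s) * (t - c) / (t - s))), by positivity, fun w ↦ ?_⟩
  rw [gaussianPDFReal, Real.coe_toNNReal _ hv.le, ← mul_assoc, mul_inv_cancel₀ (by positivity),
    one_mul, bridgeMarginal, show (c : ℝ) - s + (t - c) = t - s by ring]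
  congr 1
  have e : (t - c) / (t - s) * x + ((c : ℝ) - s) / (t - s) * y =
      x + ((c : ℝ) - s) / (t - s) * (y - x) := by
    field_simp
    ring
  rw [e]
  field_simp

theorem integrable_rho_mul_bridgeMarginal (hs : s < c) (ht : c < t)
    (hX : IsBrownianBridge s t x y X P) (hc : ∀ ω, Continuous fun u ↦ X u ω) :
    Integrable fun w ↦ rho Ld Lu Ud Uu (c - s) (t - c) x w y *
      bridgeMarginal (c - s) (t - c) x y w := by
  obtain ⟨C, -, hC⟩ := bridgeMarginal_eq hs ht x y
  refine Integrable.bdd_mul (c := 2) ?_ (measurable_rho hs ht hX hc).aestronglyMeasurable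
    (.of_forall fun w ↦ abs_rho_le hs ht hX hc w)
  rw [show bridgeMarginal (c - s) (t - c) x y = _ from funext hC]
  exact (integrable_gaussianPDFReal _ _).const_mul C

/-- The joint law of the layer event and `X c`. -/
theorem exists_setIntegral_eq (hs : s < c) (ht : c < t) (hX : IsBrownianBridge s t x y X P)
    (hL : Ld ≤ Lu) (hU : Ud ≤ Uu) : ∃ C : ℝ, 0 < C ∧ ∀ B, MeasurableSet B →
    ∫ w in B, rho Ld Lu Ud Uu (c - s) (t - c) x w y * bridgeMarginal (c - s) (t - c) x y w =
      C * (P.restrict (X c ⁻¹' B)).real (layerEvent X Ld Lu Ud Uu) := by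
  obtain ⟨C, hC0, hC⟩ := bridgeMarginal_eq hs ht x y
  obtain ⟨Y, hY, hc, -⟩ := hX.exists_continuous
  refine ⟨C, hC0, fun B hB ↦ ?_⟩
  have hv : (((c : ℝ) - s) * (t - c) / (t - s)).toNNReal ≠ 0 := by
    rw [Ne, Real.toNNReal_eq_zero, not_le]
    exact div_pos (mul_pos (sub_pos.2 hs) (sub_pos.2 ht)) (by linarith)
  have hm := measurable_rho (Ld := Ld) (Lu := Lu) (Ud := Ud) (Uu := Uu) hs ht hY hc
  rw [measureReal_restrict_layerEvent hs ht hX hL hU hB,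
    ← setIntegral_map (f := fun w ↦ rho Ld Lu Ud Uu (c - s) (t - c) x w y) hB
      hm.aestronglyMeasurable (hX.measurable c).aemeasurable, hX.map_eval,
    ← integral_indicator hB, ← integral_indicator hB, integral_gaussianReal_eq_integral_smul hv,
    ← integral_const_mul]
  refine integral_congr_ae (.of_forall fun w ↦ ?_)
  by_cases hw : w ∈ B
  · simp only [indicator_of_mem hw, hC, smul_eq_mul]
    ring
  · simp [indicator_of_notMem hw]

/-- The layer event with open layers is almost surely the layer event. -/
theorem open_layerEvent_ae_eq (hst : s < t) (hX : IsBrownianBridge s t x y X P) :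
    {ω | (Ld < pathInf (fun u ↦ X u ω) ∧ pathInf (fun u ↦ X u ω) < Lu) ∧
      (Ud < pathSup (fun u ↦ X u ω) ∧ pathSup (fun u ↦ X u ω) < Uu)} =ᵐ[P]
      layerEvent X Ld Lu Ud Uu := by
  rw [eventuallyEq_set]
  filter_upwards [hX.ae_pathInf_ne hst Ld, hX.ae_pathInf_ne hst Lu, hX.ae_pathSup_ne hst Ud,
    hX.ae_pathSup_ne hst Uu] with ω h1 h2 h3 h4
  simp only [layerEvent, mem_ofPred_eq, mem_Icc, h1.symm.le_iff_lt, h2.le_iff_lt,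
    h3.symm.le_iff_lt, h4.le_iff_lt]

/-- Every set of the σ-algebra of `X c` is some `X c ⁻¹' B`, so `measureReal_restrict_layerEvent` is
the defining property of the conditional expectation. Allowing any `E` almost surely equal to the
layer event covers the open layers. -/
theorem condExp_layerEvent (hs : s < c) (ht : c < t) (hX : IsBrownianBridge s t x y X P)
    (hL : Ld ≤ Lu) (hU : Ud ≤ Uu) {E : Set Ω} (hE : E =ᵐ[P] layerEvent X Ld Lu Ud Uu) :
    P⟦E | MeasurableSpace.comap (X c) inferInstance⟧ =ᵐ[P]
      fun ω ↦ rho Ld Lu Ud Uu (c - s) (t - c) x (X c ω) y := by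
  have := hX.isProbabilityMeasure
  obtain ⟨Y, hY, hc, -⟩ := hX.exists_continuous
  have hm := measurable_rho (Ld := Ld) (Lu := Lu) (Ud := Ud) (Uu := Uu) hs ht hY hc
  obtain ⟨A, -, hA, hAE⟩ :=
    (nullMeasurableSet_layerEvent (Ld := Ld) (Lu := Lu) (Ud := Ud) (Uu := Uu)
      (hs.trans ht) hX).exists_measurable_superset_ae_eq
  have hEA : E =ᵐ[P] A := hE.trans hAE.symm
  refine (condExp_congr_ae (indicator_ae_eq_of_ae_eq_set hEA)).trans
    (ae_eq_condExp_of_forall_setIntegral_eq (hX.measurable c).comap_le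
      ((integrable_const _).indicator hA) (fun S _ _ ↦ ?_) (fun S hS _ ↦ ?_) ?_).symm
  · refine (Integrable.of_bound (C := 2) (hm.comp (hX.measurable c)).aestronglyMeasurable
      (.of_forall fun ω ↦ abs_rho_le hs ht hY hc _)).integrableOn
  · obtain ⟨B, hB, rfl⟩ := hS
    rw [← measureReal_restrict_layerEvent hs ht hX hL hU hB,
      measureReal_congr (ae_restrict_of_ae hAE.symm), integral_indicator_const _ hA]
    simp
  · exact (hm.comp (comap_measurable (X c))).aestronglyMeasurable

theorem bridgeMarginal_nonneg (q r x y w : ℝ) : 0 ≤ bridgeMarginal q r x y w :=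
  (Real.exp_pos _).le

/-- The law of `X c` conditional on the layer event. -/
theorem map_cond_layerEvent (hs : s < c) (ht : c < t) (hX : IsBrownianBridge s t x y X P)
    (hpos : P (layerEvent X Ld Lu Ud Uu) ≠ 0) {g : ℝ → ℝ}
    (hg : ∀ w, g w = rho Ld Lu Ud Uu (c - s) (t - c) x w y *
      bridgeMarginal (c - s) (t - c) x y w) :
    (∀ w, 0 ≤ g w) ∧ Integrable g volume ∧ 0 < ∫ w, g w ∧
      (P[|layerEvent X Ld Lu Ud Uu]).map (X c) =
        volume.withDensity (fun w ↦ ENNReal.ofReal (g w / ∫ v, g v)) := by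
  have := hX.isProbabilityMeasure
  -- A point of the event forces the levels to be correctly ordered.
  obtain ⟨ω₀, hω₀⟩ := nonempty_of_measure_ne_zero hpos
  have hL : Ld ≤ Lu := hω₀.1.1.trans hω₀.1.2
  have hU : Ud ≤ Uu := hω₀.2.1.trans hω₀.2.2
  obtain ⟨Y, hY, hc, -⟩ := hX.exists_continuous
  obtain ⟨C, hC, hint⟩ := exists_setIntegral_eq hs ht hX hL hU
  simp only [← hg] at hint
  have hg0 : ∀ w, 0 ≤ g w := fun w ↦ by
    rw [hg]
    exact mul_nonneg (rho_nonneg hs ht hY hc hL hU w) (bridgeMarginal_nonneg _ _ _ _ _)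
  have hgi : Integrable g := by
    rw [funext hg]
    exact integrable_rho_mul_bridgeMarginal hs ht hY hc
  have htotal : ∫ w, g w = C * P.real (layerEvent X Ld Lu Ud Uu) := by
    have h := hint univ .univ
    rwa [Measure.restrict_univ, preimage_univ, Measure.restrict_univ] at h
  have hreal : 0 < P.real (layerEvent X Ld Lu Ud Uu) :=
    ENNReal.toReal_pos hpos (measure_ne_top _ _)
  have htpos : 0 < ∫ w, g w := by
    rw [htotal]
    exact mul_pos hC hreal
  refine ⟨hg0, hgi, htpos, ?_⟩
  ext B hB
  have hXB : MeasurableSet (X c ⁻¹' B) := hX.measurable c hB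
  -- Exchanging the two sets uses measurability of the preimage only, not of the layer event.
  have h1 : (P.restrict (X c ⁻¹' B)) (layerEvent X Ld Lu Ud Uu) =
      (P.restrict (layerEvent X Ld Lu Ud Uu)) (X c ⁻¹' B) := by
    rw [Measure.restrict_apply hXB, Measure.restrict_apply₀' hXB.nullMeasurableSet, inter_comm]
  rw [Measure.map_apply (hX.measurable c) hB, ProbabilityTheory.cond, Measure.smul_apply,
    smul_eq_mul, ← h1, withDensity_apply _ hB,
    ← ofReal_integral_eq_lintegral_ofReal (hgi.div_const _).integrableOn
      (.of_forall fun w ↦ div_nonneg (hg0 w) htpos.le),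
    integral_div, htotal, hint B hB, mul_div_mul_left _ _ hC.ne', ENNReal.ofReal_div_of_pos hreal,
    measureReal_def, measureReal_def, ENNReal.ofReal_toReal (measure_ne_top _ _),
    ENNReal.ofReal_toReal (measure_ne_top _ _), ENNReal.div_eq_inv_mul]

end

end BrownianLayer

end

theorem mainTheorem3 {Ω : Type*} [MeasurableSpace Ω] (P : Measure Ω) [IsProbabilityMeasure P]
    (s tStar t x y : ℝ) (hs : s < tStar) (ht : tStar < t)
    (X : Set.Icc s t → Ω → ℝ) (hX : BrownianLayer.IsBrownianBridge s t x y X P)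
    (Ld Lu Ud Uu : ℝ) (hpos : P (BrownianLayer.layerEvent X Ld Lu Ud Uu) ≠ 0) :
    let q : ℝ := tStar - s
    let r : ℝ := t - tStar
    let Xmid : Ω → ℝ := X ⟨tStar, hs.le, ht.le⟩
    let m : Ω → ℝ := fun ω ↦ BrownianLayer.pathInf (fun u ↦ X u ω)
    let M : Ω → ℝ := fun ω ↦ BrownianLayer.pathSup (fun u ↦ X u ω)
    let g : ℝ → ℝ := fun w ↦
      BrownianLayer.rho Ld Lu Ud Uu q r x w y * BrownianLayer.bridgeMarginal q r x y w
    P⟦{ω | (Ld < m ω ∧ m ω < Lu) ∧ (Ud < M ω ∧ M ω < Uu)} |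
        MeasurableSpace.comap Xmid inferInstance⟧
      =ᵐ[P] (fun ω ↦ BrownianLayer.rho Ld Lu Ud Uu q r x (Xmid ω) y) ∧
    (∀ w, 0 ≤ g w) ∧ Integrable g volume ∧ 0 < ∫ w, g w ∧
    (P[|BrownianLayer.layerEvent X Ld Lu Ud Uu]).map Xmid =
      volume.withDensity (fun w ↦ ENNReal.ofReal (g w / ∫ v, g v)) := by
  intro q r Xmid m M g
  obtain ⟨ω₀, hω₀⟩ := nonempty_of_measure_ne_zero hpos
  exact ⟨BrownianLayer.condExp_layerEvent hs ht hX (hω₀.1.1.trans hω₀.1.2)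
    (hω₀.2.1.trans hω₀.2.2) (BrownianLayer.open_layerEvent_ae_eq (hs.trans ht) hX),
    BrownianLayer.map_cond_layerEvent hs ht hX hpos fun _ ↦ rfl⟩
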